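/- Theorem (Spectral Estimate). Let $V:\mathbb{R}^2\to\mathbb{R}$, $V=V(\phi,\sigma)$, be a $C^2$ function such that $V(\phi,\sigma)=V(|\phi|,|\sigma|)$; $V(\pm1,0)=0$ and $V>0$ elsewhere; $V(1,y)<V(x,y)$ for all $y\in\mathbb{R}$, $x>1$, and $V(x,1)<V(x,y)$ for all $x\in\mathbb{R}$, $y>1$; $V$ has a local maximum at $(0,0)$ and $\nabla V\neq 0$ on $(-1,1)^2\setminus\{(0,0)\}$; $|\operatorname{Hess}V(\Phi)|\le C_V(1+|\Phi|^2)$ for some constant $C_V$; and $\operatorname{Hess}V(\pm1,0)\ge\lambda_* I$ for some $\lambda_*>0$. Let $d\in\mathbb{R}$, $0\le r_0<r_1\le\infty$, and for $R\in(r_0,r_1)$ let $W(\Phi,R)=V(\Phi)+\frac12\frac{d^2}{R^2}\sigma^2$, where $\Phi=(\phi,\sigma)$. For every $R\in(r_0,r_1)$ let $F_0(\cdot;R)\in C^2(\mathbb{R};\mathbb{R}^2)$ be a solution of $-F_0''+\nabla_\Phi W(F_0,R)=0$ with $\lim_{x\to\pm\infty}F_0(x;R)=(\pm1,0)$ which minimizes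 $\int_{\mathbb{R}}\left(\frac12|f'|^2+\frac12|s'|^2+W(f,s,R)\right)dx$ among all $(f,s)\in H^1_{loc}(\mathbb{R};\mathbb{R}^2)$ for which this integral is finite, $f(0)=0$ and $f(\pm\infty)=\pm1$, and which itself belongs to this class. Let $R\mapsto F_0(\cdot;R)$ be continuous on $(r_0,r_1)$ with respect to the supremum norm. For $\epsilon>0$ and a bounded continuous $P:\mathbb{R}\to\mathbb{R}^2$ let $L_\epsilon(P,R)=-\partial_{y}^2+\frac1{\epsilon^2}\operatorname{Hess}_\Phi W(P,R)$, as an operator in $L^2(\mathbb{R};\mathbb{R}^2)$ with domain $H^2(\mathbb{R};\mathbb{R}^2)$, and assume the non-degeneracy condition $$\ker L_1(F_0(\cdot;R),R)=\operatorname{span}\{F_0'(\cdot;R)\}\qquad\text{for all }R\in(r_0,r_1).$$ Write $F_0^\epsilon(y)=F_0(y/\epsilon;R)$. Then, for all $R\in(r_0,r_1)$ and $\epsilon>0$, $$\ker L_\epsilon(F_0^\epsilon,R)=\operatorname{span}\{\partial_{y}F_0^\epsilon\}.$$ Moreover, for every compact $K\subset(r_0,r_1)$ there is a constant $C>0$ such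 that for all $R\in K$, all $\epsilon>0$ and all $\xi\in H^1(\mathbb{R};\mathbb{R}^2)$ with $\int_{\mathbb{R}}\xi\cdot\partial_{y}F_0^\epsilon\,dy=0$, $$\frac1{\epsilon^2}\|\xi\|_{L^2(\mathbb{R})}^2\le C\int_{\mathbb{R}}\xi\cdot L_\epsilon(F_0^\epsilon,R)\xi\,dy ,$$ where for $\xi\in H^1$ the right-hand integral means the quadratic form $\int_{\mathbb{R}}\left(|\xi'|^2+\frac1{\epsilon^2}\,\xi\cdot\operatorname{Hess}_\Phi W(F_0^\epsilon,R)\xi\right)dy$; for $\xi\in H^2$ the inequality also holds with the integral taken literally. -/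

import Mathlib

open MeasureTheory Filter Topology Set
open scoped ContDiff

noncomputable section

/-- The plane of field values `Φ = (φ, σ)`, with `φ = Φ 0` and `σ = Φ 1`. -/
abbrev Plane : Type := EuclideanSpace ℝ (Fin 2)

/-- `u'` is the weak derivative of `u : ℝ → ℝ²`. -/
structure HasWeakDeriv (u u' : ℝ → Plane) : Prop where
  locInt : LocallyIntegrable u
  locInt_deriv : LocallyIntegrable u'
  by_parts : ∀ φ : ℝ → ℝ, ContDiff ℝ ∞ φ → HasCompactSupport φ →
    ∫ y, deriv φ y • u y = -∫ y, φ y • u' y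

/-- `u ∈ H¹(ℝ; ℝ²)`, with weak derivative `u'`. -/
structure MemHOne (u u' : ℝ → Plane) : Prop where
  memLp : MemLp u 2
  memLp_deriv : MemLp u' 2
  weak : HasWeakDeriv u u'

/-- `u ∈ H²(ℝ; ℝ²)`, with weak derivatives `u'` and `u''`. -/
structure MemHTwo (u u' u'' : ℝ → Plane) : Prop where
  memHOne : MemHOne u u'
  memHOne_deriv : MemHOne u' u''

/-- The Hessian of `U : ℝ² → ℝ` at `Φ`, as the derivative of the gradient of `U`. -/
def hess (U : Plane → ℝ) (Φ : Plane) : Plane →L[ℝ] Plane := fderiv ℝ (gradient U) Φ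

/-- The standing assumptions on the potential `V`. -/
structure PotentialAssumptions (V : Plane → ℝ) : Prop where
  contDiff : ContDiff ℝ 2 V
  even : ∀ x y : ℝ, V !₂[x, y] = V !₂[|x|, |y|]
  zero_right : V !₂[1, 0] = 0
  zero_left : V !₂[-1, 0] = 0
  pos : ∀ Φ : Plane, Φ ≠ !₂[1, 0] → Φ ≠ !₂[-1, 0] → 0 < V Φ
  mono_fst : ∀ x y : ℝ, 1 < x → V !₂[1, y] < V !₂[x, y]
  mono_snd : ∀ x y : ℝ, 1 < y → V !₂[x, 1] < V !₂[x, y]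
  localMax : IsLocalMax V 0
  gradient_ne : ∀ Φ : Plane, Φ 0 ∈ Ioo (-1 : ℝ) 1 → Φ 1 ∈ Ioo (-1 : ℝ) 1 → Φ ≠ 0 →
    gradient V Φ ≠ 0
  hess_growth : ∃ C : ℝ, ∀ Φ : Plane, ‖hess V Φ‖ ≤ C * (1 + ‖Φ‖ ^ 2)
  hess_pos : ∃ lam : ℝ, 0 < lam ∧ ∀ v : Plane,
    lam * ‖v‖ ^ 2 ≤ inner ℝ v (hess V !₂[1, 0] v) ∧
    lam * ‖v‖ ^ 2 ≤ inner ℝ v (hess V !₂[-1, 0] v)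

/-- The shifted potential `W(Φ, R) = V(Φ) + (1/2) (d²/R²) σ²`. -/
def shiftedPotential (V : Plane → ℝ) (d R : ℝ) (Φ : Plane) : ℝ :=
  V Φ + 1 / 2 * (d ^ 2 / R ^ 2) * Φ 1 ^ 2

/-- The energy density `½|G'|² + W(G, R)`. -/
def energyDensity (V : Plane → ℝ) (d R : ℝ) (G G' : ℝ → Plane) (y : ℝ) : ℝ :=
  1 / 2 * ‖G' y‖ ^ 2 + shiftedPotential V d R (G y)

/-- The class `𝒜`: `G = (f, s)` is (the continuous representative of) an `H¹_loc` function with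
weak derivative `G'`, has finite energy, and satisfies `f(0) = 0` and `f(±∞) = ±1`. The energy
density is nonnegative, so that finite energy means that it is integrable. -/
structure Admissible (V : Plane → ℝ) (d R : ℝ) (G G' : ℝ → Plane) : Prop where
  continuous : Continuous G
  weak : HasWeakDeriv G G'
  locMemLp_deriv : ∀ K : Set ℝ, IsCompact K → MemLp G' 2 (volume.restrict K)
  finite_energy : Integrable (energyDensity V d R G G')
  zero : G 0 0 = 0
  lim_right : Tendsto (fun y => G y 0) atTop (𝓝 1)
  lim_left : Tendsto (fun y => G y 0) atBot (𝓝 (-1))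

/-- `F` is an interface profile for the parameter `R`: a solution of `-F'' + ∇W(F, R) = 0`
connecting `(-1, 0)` to `(1, 0)` and minimizing the energy in the class `𝒜`. -/
structure IsProfile (V : Plane → ℝ) (d R : ℝ) (F : ℝ → Plane) : Prop where
  contDiff : ContDiff ℝ 2 F
  equation : ∀ y, -deriv (deriv F) y + gradient (shiftedPotential V d R) (F y) = 0
  lim_right : Tendsto F atTop (𝓝 !₂[1, 0])
  lim_left : Tendsto F atBot (𝓝 !₂[-1, 0])
  admissible : Admissible V d R F (deriv F)
  minimal : ∀ G G' : ℝ → Plane, Admissible V d R G G' →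
    ∫ y, energyDensity V d R F (deriv F) y ≤ ∫ y, energyDensity V d R G G' y

/-- The value `L_ε u = -u'' + ε⁻² Hess W(P, R) u` of the operator linearized about `P`, for `u`
with second derivative `u''`. Its domain is `H²(ℝ; ℝ²)`. -/
def linOp (V : Plane → ℝ) (d R ε : ℝ) (P : ℝ → Plane) (u u'' : ℝ → Plane) (y : ℝ) : Plane :=
  -u'' y + (1 / ε ^ 2) • hess (shiftedPotential V d R) (P y) (u y)

/-- The kernel of `L_ε` in `L²(ℝ; ℝ²)`: all functions `u ∈ H²` such that `L_ε u = 0` a.e. -/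
def linKer (V : Plane → ℝ) (d R ε : ℝ) (P : ℝ → Plane) : Set (ℝ → Plane) :=
  {u | ∃ u' u'' : ℝ → Plane, MemHTwo u u' u'' ∧ linOp V d R ε P u u'' =ᵐ[volume] 0}

/-- The line spanned by `g`, functions being identified when they agree a.e. -/
def aeSpan (g : ℝ → Plane) : Set (ℝ → Plane) :=
  {u | ∃ c : ℝ, u =ᵐ[volume] c • g}

/-- The quadratic form `∫ u · L_ε u` on `H¹`, that is `∫ |u'|² + ε⁻² u · Hess W(P, R) u`. -/
def linForm (V : Plane → ℝ) (d R ε : ℝ) (P : ℝ → Plane) (u u' : ℝ → Plane) : ℝ :=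
  ∫ y, (‖u' y‖ ^ 2
    + 1 / ε ^ 2 * inner ℝ (u y) (hess (shiftedPotential V d R) (P y) (u y)))

/-- The rescaled profile `y ↦ F(y/ε)`. -/
def rescale (ε : ℝ) (F : ℝ → Plane) (y : ℝ) : Plane := F (y / ε)

/-- The interval `(r₀, r₁)`, where `r₁` may be infinite. -/
def paramInterval (r₀ : ℝ) (r₁ : EReal) : Set ℝ := {R | r₀ < R ∧ (R : EReal) < r₁}

end

/-! ### Weak derivatives on the line: operations, primitives, integration by parts. -/

section WeakDerivatives

variable {u u' v v' : ℝ → Plane}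

/-! Everything reduces to `ε = 1` by the dilation `y ↦ ε y`, which conjugates `L_ε` to `ε⁻² L_1`.
The kernel statement is then exactly the non-degeneracy assumption, and the estimate becomes a lower
bound for `Q_R(u) = ∫ |u'|² + u · Hess W(F_0, R) u` on the orthogonal complement of `F_0'`, uniform
for `R ∈ K`.

For fixed `R`, minimality gives `Q_R ≥ 0`: the energies of `F_0 + tξ` and `F_0 - tξ` add up to at
least twice that of `F_0`, and dividing by `t²` leaves the second variation
(`IsProfile.quadForm_nonneg`). Since the Hessian is positive at the two wells, `Q_R` is coercive
outside a compact interval; inside, Poincaré's inequality on short intervals makes it coercive up to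
finitely many averages (`exists_quadForm_coercive`). A nonnegative form that is coercive up to
finitely many functionals is coercive wherever it is definite (`exists_coercive_of_finite_defect`).
Definiteness on the complement of `F_0'` is non-degeneracy: a null vector of a nonnegative form
solves the linear equation, so it is a multiple of `F_0'`.

Uniformity in `R` rests on `HasGap.perturb`. If `R'` is near `R`, the two Hessians along the
profiles differ by at most `δ` uniformly on the line, and both forms have a null direction. The null
direction of the second is almost null for the first, so the gap of the first forces the two
directions to be nearly parallel, and the gap constant drops by at most `2δ`. Only uniform closeness
of the profiles enters, not closeness of their derivatives in `L²`. Compactness of `K` finishes the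
argument. -/

theorem HasWeakDeriv.congr (h : HasWeakDeriv u u') (hu : u =ᵐ[volume] v)
    (hu' : u' =ᵐ[volume] v') : HasWeakDeriv v v' where
  locInt := h.locInt.congr hu
  locInt_deriv := h.locInt_deriv.congr hu'
  by_parts φ hφ hc := by
    have h1 : ∫ y, deriv φ y • v y = ∫ y, deriv φ y • u y :=
      integral_congr_ae (hu.mono fun y hy => by simp [hy])
    have h2 : ∫ y, φ y • v' y = ∫ y, φ y • u' y :=
      integral_congr_ae (hu'.mono fun y hy => by simp [hy])
    rw [h1, h2, h.by_parts φ hφ hc]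

theorem integrable_smul_of_smooth (hu : LocallyIntegrable u) {φ : ℝ → ℝ} (hφ : Continuous φ)
    (hc : HasCompactSupport φ) : Integrable fun y => φ y • u y :=
  hu.integrable_smul_left_of_hasCompactSupport hφ hc

theorem integrable_deriv_smul_of_smooth (hu : LocallyIntegrable u) {φ : ℝ → ℝ}
    (hφ : ContDiff ℝ ∞ φ) (hc : HasCompactSupport φ) : Integrable fun y => deriv φ y • u y :=
  integrable_smul_of_smooth hu (hφ.continuous_deriv (by simp)) hc.deriv

theorem HasWeakDeriv.add (h : HasWeakDeriv u u') (k : HasWeakDeriv v v') :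
    HasWeakDeriv (u + v) (u' + v') where
  locInt := h.locInt.add k.locInt
  locInt_deriv := h.locInt_deriv.add k.locInt_deriv
  by_parts φ hφ hc := by
    simp only [Pi.add_apply, smul_add]
    rw [integral_add (integrable_deriv_smul_of_smooth h.locInt hφ hc)
        (integrable_deriv_smul_of_smooth k.locInt hφ hc),
      integral_add (integrable_smul_of_smooth h.locInt_deriv hφ.continuous hc)
        (integrable_smul_of_smooth k.locInt_deriv hφ.continuous hc),
      h.by_parts φ hφ hc, k.by_parts φ hφ hc, neg_add]

theorem HasWeakDeriv.const_smul (h : HasWeakDeriv u u') (c : ℝ) :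
    HasWeakDeriv (c • u) (c • u') where
  locInt := h.locInt.smul c
  locInt_deriv := h.locInt_deriv.smul c
  by_parts φ hφ hc := by
    simp only [Pi.smul_apply, smul_comm _ c]
    rw [integral_smul, integral_smul, h.by_parts φ hφ hc, smul_neg]

theorem HasWeakDeriv.smooth_smul (h : HasWeakDeriv u u') {χ : ℝ → ℝ} (hχ : ContDiff ℝ ∞ χ) :
    HasWeakDeriv (fun y => χ y • u y) (fun y => deriv χ y • u y + χ y • u' y) where
  locInt := h.locInt.continuous_smul hχ.continuous
  locInt_deriv := (h.locInt.continuous_smul (hχ.continuous_deriv (by simp))).add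
    (h.locInt_deriv.continuous_smul hχ.continuous)
  by_parts φ hφ hc := by
    have hd : ∀ y, deriv (fun z => φ z * χ z) y = deriv φ y * χ y + φ y * deriv χ y := fun y =>
      deriv_fun_mul (hφ.differentiable (by simp) y) (hχ.differentiable (by simp) y)
    have hcc : HasCompactSupport fun z => φ z * χ z := hc.mul_right
    have key := h.by_parts (fun z => φ z * χ z) (hφ.mul hχ) hcc
    have i1 : Integrable fun y => (deriv φ y * χ y) • u y :=
      integrable_smul_of_smooth h.locInt ((hφ.continuous_deriv (by simp)).mul hχ.continuous)
        hc.deriv.mul_right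
    have i2 : Integrable fun y => (φ y * deriv χ y) • u y :=
      integrable_smul_of_smooth h.locInt (hφ.continuous.mul (hχ.continuous_deriv (by simp)))
        hc.mul_right
    have i3 : Integrable fun y => (φ y * χ y) • u' y :=
      integrable_smul_of_smooth h.locInt_deriv (hφ.continuous.mul hχ.continuous) hc.mul_right
    simp only [hd, add_smul] at key
    rw [integral_add i1 i2] at key
    simp only [smul_add, smul_smul]
    rw [integral_add i2 i3, eq_sub_of_add_eq key]
    abel

theorem hasWeakDeriv_of_contDiff {f : ℝ → Plane} (hf : ContDiff ℝ 1 f) :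
    HasWeakDeriv f (deriv f) where
  locInt := hf.continuous.locallyIntegrable
  locInt_deriv := (hf.continuous_deriv le_rfl).locallyIntegrable
  by_parts φ hφ hc := by
    have hfd := hf.differentiable one_ne_zero
    have := integral_bilinear_hasDerivAt_right_eq_neg_left_of_integrable
      (L := ContinuousLinearMap.lsmul ℝ ℝ) (u := φ) (u' := deriv φ) (v := f) (v' := deriv f)
      (fun x _ => (hφ.differentiable (by simp) x).hasDerivAt) (fun x _ => (hfd x).hasDerivAt)
      (integrable_smul_of_smooth (hf.continuous_deriv le_rfl).locallyIntegrable hφ.continuous hc)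
      (integrable_deriv_smul_of_smooth hf.continuous.locallyIntegrable hφ hc)
      (integrable_smul_of_smooth hf.continuous.locallyIntegrable hφ.continuous hc)
    simp only [ContinuousLinearMap.lsmul_apply] at this
    rw [this, neg_neg]

theorem MeasureTheory.LocallyIntegrable.comp_add (hu : LocallyIntegrable u) (a : ℝ) :
    LocallyIntegrable fun y => u (y + a) := by
  have h := locallyIntegrable_map_homeomorph (Homeomorph.addRight a) (f := u) (μ := volume)
  rw [Homeomorph.coe_addRight, map_add_right_eq_self] at h
  exact h.1 hu

theorem MeasureTheory.LocallyIntegrable.comp_mul (hu : LocallyIntegrable u) {a : ℝ} (ha : a ≠ 0) :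
    LocallyIntegrable fun y => u (a * y) := by
  have h := locallyIntegrable_map_homeomorph (Homeomorph.mulLeft₀ a ha) (f := u) (μ := volume)
  rw [Homeomorph.coe_mulLeft₀, Real.map_volume_mul_left ha] at h
  refine h.1 fun x => ?_
  obtain ⟨s, hs, hsu⟩ := hu x
  exact ⟨s, hs, by
    rw [IntegrableOn, Measure.restrict_smul]
    exact hsu.smul_measure ENNReal.ofReal_ne_top⟩

theorem HasWeakDeriv.comp_add (h : HasWeakDeriv u u') (a : ℝ) :
    HasWeakDeriv (fun y => u (y + a)) (fun y => u' (y + a)) where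
  locInt := LocallyIntegrable.comp_add h.locInt a
  locInt_deriv := LocallyIntegrable.comp_add h.locInt_deriv a
  by_parts φ hφ hc := by
    have hd : ∀ y, deriv (fun z => φ (z - a)) y = deriv φ (y - a) := fun y =>
      deriv_comp_sub_const ..
    have key := h.by_parts (fun z => φ (z - a)) (hφ.comp (contDiff_id.sub contDiff_const))
      (hc.comp_homeomorph (Homeomorph.subRight a))
    simp only [hd] at key
    rw [← integral_add_right_eq_self _ a, ← integral_add_right_eq_self (fun y => _ • u' y) a] at key
    simpa using key

theorem HasWeakDeriv.comp_mul (h : HasWeakDeriv u u') {a : ℝ} (ha : a ≠ 0) :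
    HasWeakDeriv (fun y => u (a * y)) (fun y => a • u' (a * y)) where
  locInt := LocallyIntegrable.comp_mul h.locInt ha
  locInt_deriv := (LocallyIntegrable.comp_mul h.locInt_deriv ha).smul a
  by_parts φ hφ hc := by
    have hd : ∀ y, deriv (fun z => φ (a⁻¹ * z)) y = a⁻¹ * deriv φ (a⁻¹ * y) := fun y => by
      rw [deriv_comp_mul_left a⁻¹ φ y, smul_eq_mul]
    have key := h.by_parts (fun z => φ (a⁻¹ * z)) (hφ.comp (contDiff_const.mul contDiff_id))
      (hc.comp_homeomorph (Homeomorph.mulLeft₀ a⁻¹ (inv_ne_zero ha)))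
    simp only [hd] at key
    have e1 := Measure.integral_comp_mul_left (fun y => (a⁻¹ * deriv φ (a⁻¹ * y)) • u y) a
    have e2 := Measure.integral_comp_mul_left (fun y => φ (a⁻¹ * y) • u' y) a
    rw [key, smul_neg, ← e2] at e1
    simp only [inv_mul_cancel_left₀ ha, mul_smul] at e1
    rw [integral_smul, inv_smul_eq_iff₀ ha] at e1
    rw [e1, smul_neg, ← integral_smul]
    simp only [smul_comm a]

theorem MeasureTheory.LocallyIntegrable.apply_coord (hu : LocallyIntegrable u) (i : Fin 2) :
    LocallyIntegrable fun y => u y i := fun x => by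
  obtain ⟨s, hs, h⟩ := hu x
  exact ⟨s, hs, (EuclideanSpace.proj (𝕜 := ℝ) i).integrable_comp h⟩

theorem integral_coord {μ : Measure ℝ} (hu : Integrable u μ) (i : Fin 2) :
    (∫ y, u y ∂μ) i = ∫ y, u y i ∂μ :=
  ((EuclideanSpace.proj (𝕜 := ℝ) i).integral_comp_comm hu).symm

theorem MeasureTheory.LocallyIntegrable.intervalIntegrable' {E : Type*} [NormedAddCommGroup E]
    {f : ℝ → E} (hf : LocallyIntegrable f) (a b : ℝ) : IntervalIntegrable f volume a b :=
  (hf.integrableOn_isCompact isCompact_uIcc).intervalIntegrable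

theorem intervalIntegral_coord (hu : LocallyIntegrable u) (a b : ℝ) (i : Fin 2) :
    (∫ y in a..b, u y) i = ∫ y in a..b, u y i :=
  ((EuclideanSpace.proj (𝕜 := ℝ) i).intervalIntegral_comp_comm (hu.intervalIntegrable' a b)).symm

/-- The primitive of `u'` vanishing at `0`. -/
noncomputable def primitive (u' : ℝ → Plane) (y : ℝ) : Plane := ∫ t in (0 : ℝ)..y, u' t

theorem continuous_primitive (hu : LocallyIntegrable u) : Continuous (primitive u) :=
  intervalIntegral.continuous_primitive hu.intervalIntegrable' 0

theorem primitive_coord (hu : LocallyIntegrable u) (i : Fin 2) (y : ℝ) :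
    primitive u y i = ∫ t in (0 : ℝ)..y, u t i := intervalIntegral_coord hu 0 y i

/-- Scalar coordinates give access to the product rule for absolutely continuous functions; the
constant `c` covers the continuous representatives of `H¹` functions. -/
theorem absolutelyContinuous_primitive_coord (hu : LocallyIntegrable u) (i : Fin 2) (c : ℝ)
    {a b : ℝ} (h0 : 0 ∈ uIcc a b) :
    AbsolutelyContinuousOnInterval (fun y => c + primitive u y i) a b := by
  have h1 : AbsolutelyContinuousOnInterval (fun _ : ℝ => c) a b :=
    ContDiffOn.absolutelyContinuousOnInterval contDiff_const.contDiffOn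
  have := h1.add
    (((hu.apply_coord i).intervalIntegrable' a b).absolutelyContinuousOnInterval_intervalIntegral
      h0)
  have hp : (fun y => c + primitive u y i) = fun y => c + ∫ t in (0 : ℝ)..y, u t i :=
    funext fun y => by rw [primitive_coord hu]
  rw [hp]
  exact this

theorem ae_deriv_primitive_coord (hu : LocallyIntegrable u) (i : Fin 2) (c : ℝ) :
    deriv (fun y => c + primitive u y i) =ᵐ[volume] fun y => u y i := by
  filter_upwards [LocallyIntegrable.ae_hasDerivAt_integral (hu.apply_coord i)] with y hy
  have hp : (fun y => c + primitive u y i) = fun y => c + ∫ t in (0 : ℝ)..y, u t i :=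
    funext fun y => by rw [primitive_coord hu]
  rw [hp]
  exact ((hy 0).const_add c).deriv

/-- On an interval containing the support of the test function, this is integration by parts for
absolutely continuous functions, one coordinate at a time, with vanishing boundary terms. -/
theorem hasWeakDeriv_primitive (hu : LocallyIntegrable u) : HasWeakDeriv (primitive u) u where
  locInt := (continuous_primitive hu).locallyIntegrable
  locInt_deriv := hu
  by_parts φ hφ hc := by
    have hp := (continuous_primitive hu).locallyIntegrable (μ := volume)
    ext i
    rw [PiLp.neg_apply, integral_coord (integrable_deriv_smul_of_smooth hp hφ hc),
      integral_coord (integrable_smul_of_smooth hu hφ.continuous hc)]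
    obtain ⟨N, hN0, hN⟩ : ∃ N : ℝ, 0 ≤ N ∧ tsupport φ ⊆ Ioo (-N) N := by
      obtain ⟨N, hN0, hN⟩ := hc.isCompact.isBounded.subset_ball_lt 0 0
      exact ⟨N, hN0.le, by rwa [Real.ball_eq_Ioo, zero_sub, zero_add] at hN⟩
    have hnn : -N ≤ N := by linarith
    have hs : ∀ f : ℝ → ℝ, (∀ y ∉ tsupport φ, f y = 0) → ∫ y, f y = ∫ y in (-N)..N, f y := by
      intro f hf
      rw [intervalIntegral.integral_of_le hnn, setIntegral_eq_integral_of_forall_compl_eq_zero]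
      intro y hy
      exact hf y fun h => hy (Ioo_subset_Ioc_self (hN h))
    have hφ0 : ∀ y ∉ tsupport φ, φ y = 0 := fun y hy => image_eq_zero_of_notMem_tsupport hy
    have hdφ0 : ∀ y ∉ tsupport φ, deriv φ y = 0 := fun y hy =>
      image_eq_zero_of_notMem_tsupport fun h => hy (tsupport_deriv_subset h)
    have hac := absolutelyContinuous_primitive_coord hu i 0 (a := -N) (b := N)
      (by rw [uIcc_of_le hnn]; constructor <;> linarith)
    have hφac : AbsolutelyContinuousOnInterval φ (-N) N :=
      ContDiffOn.absolutelyContinuousOnInterval (hφ.of_le (by simp)).contDiffOn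
    have hb : φ N = 0 ∧ φ (-N) = 0 :=
      ⟨hφ0 _ fun h => (hN h).2.false, hφ0 _ fun h => (hN h).1.false⟩
    have key := hac.integral_mul_deriv_eq_deriv_mul hφac
    simp only [hb.1, hb.2, mul_zero, sub_zero, zero_sub, zero_add] at key
    simp only [PiLp.smul_apply, smul_eq_mul]
    rw [hs _ fun y hy => by simp [hdφ0 y hy], hs _ fun y hy => by simp [hφ0 y hy]]
    simp only [mul_comm _ (primitive u _ i)]
    rw [key]
    congr 1
    refine intervalIntegral.integral_congr_ae ?_
    have := ae_deriv_primitive_coord hu i 0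
    simp only [zero_add] at this
    filter_upwards [this] with y hy _
    rw [hy, mul_comm]

/-- A function with vanishing weak derivative is constant. -/
theorem HasWeakDeriv.ae_eq_const (h : HasWeakDeriv u 0) : ∃ c : Plane, u =ᵐ[volume] fun _ => c := by
  obtain ⟨η⟩ : Nonempty (ContDiffBump (0 : ℝ)) := inferInstance
  set e : ℝ → ℝ := η.normed volume with he
  have he1 : ∫ y, e y = 1 := η.integral_normed
  have hec : HasCompactSupport e := η.hasCompactSupport_normed
  have hes : ContDiff ℝ ∞ e := η.contDiff_normed
  refine ⟨∫ y, e y • u y, ae_eq_of_integral_contDiff_smul_eq h.locInt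
    (locallyIntegrable_const _) fun g hg hgc => ?_⟩
  set m : ℝ := ∫ y, g y with hm
  -- Removing the mean of `g` with the unit-mass bump `e` makes the primitive of `k` compactly
  -- supported, hence a legitimate test function.
  set k : ℝ → ℝ := fun y => g y - m * e y with hk
  have hks : ContDiff ℝ ∞ k := hg.sub (contDiff_const.mul hes)
  have hkc : HasCompactSupport k := hgc.sub hec.mul_left
  have hki : ∫ y, k y = 0 := by
    simp only [hk]
    rw [integral_sub (hg.continuous.integrable_of_hasCompactSupport hgc)
      ((hes.continuous.integrable_of_hasCompactSupport hec).const_mul m), integral_const_mul, he1]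
    simp [hm]
  have hkI : Integrable k := hks.continuous.integrable_of_hasCompactSupport hkc
  obtain ⟨N, hN0, hN⟩ : ∃ N : ℝ, 0 < N ∧ tsupport k ⊆ Ioo (-N) N := by
    obtain ⟨N, hN0, hN⟩ := hkc.isCompact.isBounded.subset_ball_lt 0 0
    exact ⟨N, hN0, by rwa [Real.ball_eq_Ioo, zero_sub, zero_add] at hN⟩
  have hk0 : ∀ y, y ∉ Ioo (-N) N → k y = 0 := fun y hy =>
    image_eq_zero_of_notMem_tsupport fun h => hy (hN h)
  set φ : ℝ → ℝ := fun y => ∫ t in (-N)..y, k t with hφ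
  have hd : ∀ y, HasDerivAt φ (k y) y := fun y => hks.continuous.integral_hasStrictDerivAt _ _ |>.hasDerivAt
  have hdφ : deriv φ = k := funext fun y => (hd y).deriv
  have hφs : ContDiff ℝ ∞ φ := by
    rw [show (∞ : WithTop ℕ∞) = ∞ + 1 by rfl, contDiff_succ_iff_deriv]
    exact ⟨fun y => (hd y).differentiableAt, by simp, hdφ ▸ hks⟩
  have hφc : HasCompactSupport φ := by
    refine HasCompactSupport.intro (isCompact_Icc (a := -N) (b := N)) fun y hy => ?_
    rw [mem_Icc, not_and_or, not_le, not_le] at hy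
    rcases hy with hy | hy
    · simp only [hφ]
      rw [intervalIntegral.integral_symm, intervalIntegral.integral_congr (g := fun _ => (0 : ℝ))]
      · simp
      · intro t ht
        rw [uIcc_of_le hy.le] at ht
        exact hk0 t fun h => h.1.not_ge ht.2
    · simp only [hφ]
      rw [intervalIntegral.integral_of_le (by linarith),
        setIntegral_eq_integral_of_forall_compl_eq_zero, hki]
      intro t ht
      exact hk0 t fun h => ht ⟨h.1, h.2.le.trans hy.le⟩
  have key := h.by_parts φ hφs hφc
  simp only [hdφ, Pi.zero_apply, smul_zero, integral_zero, neg_zero, hk, sub_smul, mul_smul] at key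
  have i2 : Integrable fun y => m • e y • u y :=
    (integrable_smul_of_smooth h.locInt hes.continuous hec).smul m
  rw [integral_sub (integrable_smul_of_smooth h.locInt hg.continuous hgc) i2, integral_smul,
    sub_eq_zero] at key
  rw [key, integral_smul_const]

theorem HasWeakDeriv.ae_eq_primitive (h : HasWeakDeriv u u') :
    ∃ c : Plane, u =ᵐ[volume] fun y => c + primitive u' y := by
  have h0 : HasWeakDeriv (u + (-1 : ℝ) • primitive u') 0 := by
    have := h.add ((hasWeakDeriv_primitive h.locInt_deriv).const_smul (-1))
    simpa using this
  obtain ⟨c, hc⟩ := h0.ae_eq_const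
  refine ⟨c, hc.mono fun y hy => ?_⟩
  simp only [Pi.add_apply, Pi.neg_apply, neg_smul, one_smul] at hy
  simp only [← hy, neg_add_cancel_right]

theorem HasWeakDeriv.exists_continuous (h : HasWeakDeriv u u') :
    ∃ w : ℝ → Plane, Continuous w ∧ u =ᵐ[volume] w := by
  obtain ⟨c, hc⟩ := h.ae_eq_primitive
  exact ⟨_, continuous_const.add (continuous_primitive h.locInt_deriv), hc⟩

/-- The fundamental theorem of calculus for the inner product of two absolutely continuous curves.
-/
theorem integral_inner_deriv_primitive (hu : LocallyIntegrable u) (hv : LocallyIntegrable v)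
    (c d : Plane) (b : ℝ) :
    ∫ y in (0 : ℝ)..b, (inner ℝ (u y) (d + primitive v y) + inner ℝ (c + primitive u y) (v y)) =
      inner ℝ (c + primitive u b) (d + primitive v b) - inner ℝ c d := by
  have key : ∀ i : Fin 2, IntervalIntegrable
      (fun y => u y i * (d i + primitive v y i) + (c i + primitive u y i) * v y i) volume 0 b ∧
      ∫ y in (0 : ℝ)..b, (u y i * (d i + primitive v y i) + (c i + primitive u y i) * v y i) =
      (c i + primitive u b i) * (d i + primitive v b i) - c i * d i := by
    intro i
    have h0 : (0 : ℝ) ∈ uIcc 0 b := left_mem_uIcc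
    have hU := absolutelyContinuous_primitive_coord hu i (c i) h0
    have hV := absolutelyContinuous_primitive_coord hv i (d i) h0
    have := hU.integral_deriv_mul_eq_sub hV
    have z : ∀ w : ℝ → Plane, primitive w 0 = 0 := fun w => intervalIntegral.integral_same
    refine ⟨(((hu.apply_coord i).intervalIntegrable' 0 b).mul_continuousOn hV.continuousOn).add
      (((hv.apply_coord i).intervalIntegrable' 0 b).continuousOn_mul hU.continuousOn), ?_⟩
    simp only [z, PiLp.zero_apply, add_zero] at this
    rw [← this]
    refine intervalIntegral.integral_congr_ae ?_
    filter_upwards [ae_deriv_primitive_coord hu i (c i), ae_deriv_primitive_coord hv i (d i)]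
      with y h1 h2 _
    rw [h1, h2]
  simp only [PiLp.inner_apply, Fin.sum_univ_two, RCLike.inner_apply, conj_trivial, PiLp.add_apply]
  have := congrArg₂ (· + ·) (key 0).2 (key 1).2
  simp only at this
  rw [← intervalIntegral.integral_add (key 0).1 (key 1).1] at this
  convert this using 1
  · refine intervalIntegral.integral_congr fun y _ => ?_
    simp only
    ring
  · ring

theorem memLp_inner_integrable (hu : MemLp u 2) (hv : MemLp v 2) :
    Integrable fun y => (inner ℝ (u y) (v y) : ℝ) := by
  refine (L2.integrable_inner (𝕜 := ℝ) (hu.toLp u) (hv.toLp v)).congr ?_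
  filter_upwards [hu.coeFn_toLp, hv.coeFn_toLp] with y h1 h2
  rw [h1, h2]

/-- Integration by parts on the line for functions in `H¹`. -/
theorem MemHOne.integral_inner_deriv (hu : MemHOne u u') (hv : MemHOne v v') :
    ∫ y, (inner ℝ (u y) (v' y) : ℝ) = -∫ y, (inner ℝ (u' y) (v y) : ℝ) := by
  obtain ⟨c, hc⟩ := hu.weak.ae_eq_primitive
  obtain ⟨d, hd⟩ := hv.weak.ae_eq_primitive
  set U : ℝ → Plane := fun y => c + primitive u' y with hU
  set V : ℝ → Plane := fun y => d + primitive v' y with hV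
  have i1 := memLp_inner_integrable hu.memLp_deriv hv.memLp
  have i2 := memLp_inner_integrable hu.memLp hv.memLp_deriv
  have e1 : (fun y => (inner ℝ (u' y) (v y) : ℝ) + inner ℝ (u y) (v' y)) =ᵐ[volume]
      fun y => (inner ℝ (u' y) (V y) : ℝ) + inner ℝ (U y) (v' y) := by
    filter_upwards [hc, hd] with y h1 h2
    rw [h1, h2]
  have i3 : Integrable fun y => (inner ℝ (u' y) (V y) : ℝ) + inner ℝ (U y) (v' y) :=
    (i1.add i2).congr e1
  have i4 : Integrable fun y => (inner ℝ (U y) (V y) : ℝ) :=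
    (memLp_inner_integrable hu.memLp hv.memLp).congr (by
      filter_upwards [hc, hd] with y h1 h2
      rw [h1, h2])
  have hform := integral_inner_deriv_primitive hu.weak.locInt_deriv hv.weak.locInt_deriv c d
  -- The derivative of `⟨U, V⟩` is integrable, so `⟨U, V⟩` has limits at both ends; being integrable
  -- itself, it can only tend to zero there.
  have top : Tendsto (fun b => (inner ℝ (U b) (V b) : ℝ)) atTop
      (𝓝 ((∫ y in Ioi 0, ((inner ℝ (u' y) (V y) : ℝ) + inner ℝ (U y) (v' y))) + inner ℝ c d)) := by
    refine ((intervalIntegral_tendsto_integral_Ioi 0 i3.integrableOn tendsto_id).add_const _).congr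
      fun b => ?_
    simp only [id, hU, hV, hform, sub_add_cancel]
  have bot : Tendsto (fun b => (inner ℝ (U b) (V b) : ℝ)) atBot
      (𝓝 (-(∫ y in Iic 0, ((inner ℝ (u' y) (V y) : ℝ) + inner ℝ (U y) (v' y))) + inner ℝ c d)) := by
    refine ((intervalIntegral_tendsto_integral_Iic 0 i3.integrableOn tendsto_id).neg.add_const
      _).congr fun b => ?_
    simp only [id]
    rw [intervalIntegral.integral_symm, neg_neg]
    simp only [hU, hV, hform, sub_add_cancel]
  have ht := IntegrableAtFilter.eq_zero_of_tendsto (i4.integrableAtFilter _) (fun s hs => by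
    obtain ⟨b, hb⟩ := mem_atTop_sets.1 hs
    exact measure_mono_top (s₁ := Ici b) hb Real.volume_Ici) top
  have hb := IntegrableAtFilter.eq_zero_of_tendsto (i4.integrableAtFilter _) (fun s hs => by
    obtain ⟨b, hb⟩ := mem_atBot_sets.1 hs
    exact measure_mono_top (s₁ := Iic b) hb Real.volume_Iic) bot
  have hsum : ∫ y, ((inner ℝ (u' y) (V y) : ℝ) + inner ℝ (U y) (v' y)) = 0 := by
    rw [← integral_add_compl measurableSet_Iic i3 (s := Iic 0), compl_Iic]
    linarith
  rw [← integral_congr_ae e1, integral_add i1 i2] at hsum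
  linarith

end WeakDerivatives

/-! ### Hessians and second symmetric differences. -/

section Hessian

variable {U : Plane → ℝ}

theorem contDiff_gradient (hU : ContDiff ℝ 2 U) : ContDiff ℝ 1 (gradient U) :=
  (InnerProductSpace.toDual ℝ Plane).symm.toContinuousLinearEquiv.contDiff.comp
    (hU.fderiv_right (m := 1) (by norm_num))

theorem continuous_hess (hU : ContDiff ℝ 2 U) : Continuous (hess U) :=
  (contDiff_gradient hU).continuous_fderiv one_ne_zero

theorem hasFDerivAt_gradient (hU : ContDiff ℝ 2 U) (p : Plane) :
    HasFDerivAt (gradient U) (hess U p) p :=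
  ((contDiff_gradient hU).differentiable one_ne_zero p).hasFDerivAt

theorem hess_inner (hU : ContDiff ℝ 2 U) (p v w : Plane) :
    inner ℝ (hess U p v) w = fderiv ℝ (fderiv ℝ U) p v w := by
  have h : HasFDerivAt (gradient U) _ p :=
    (InnerProductSpace.toDual ℝ Plane).symm.toContinuousLinearEquiv.toContinuousLinearMap.hasFDerivAt.comp
      p ((hU.fderiv_right (m := 1) (by norm_num)).differentiable one_ne_zero p).hasFDerivAt
  rw [hess, h.fderiv]
  exact InnerProductSpace.toDual_symm_apply

theorem hess_symm (hU : ContDiff ℝ 2 U) (p v w : Plane) :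
    inner ℝ (hess U p v) w = (inner ℝ v (hess U p w) : ℝ) := by
  rw [real_inner_comm (hess U p w) v, hess_inner hU, hess_inner hU]
  exact (hU.contDiffAt.isSymmSndFDerivAt (by simp)) v w

theorem hasDerivAt_line (hU : ContDiff ℝ 2 U) (p v : Plane) (t : ℝ) :
    HasDerivAt (fun s : ℝ => U (p + s • v)) (inner ℝ (gradient U (p + t • v)) v) t := by
  have h1 := ((hU.differentiable two_ne_zero (p + t • v)).hasGradientAt).hasFDerivAt
  have h2 : HasDerivAt (fun s : ℝ => p + s • v) v t := by
    simpa using ((hasDerivAt_id t).smul_const v).const_add p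
  exact h1.comp_hasDerivAt t h2

theorem hasDerivAt_gradient_line (hU : ContDiff ℝ 2 U) (p v : Plane) (t : ℝ) :
    HasDerivAt (fun s : ℝ => gradient U (p + s • v)) (hess U (p + t • v) v) t := by
  have h2 : HasDerivAt (fun s : ℝ => p + s • v) v t := by
    simpa using ((hasDerivAt_id t).smul_const v).const_add p
  exact (hasFDerivAt_gradient hU (p + t • v)).comp_hasDerivAt t h2

/-- The mean value inequality is applied twice on `[0, 1]`: first to the gradient remainder `G`,
whose derivative is controlled by the oscillation of the Hessian, then to the remainder `k`, whose
derivative is `⟨G, v⟩`. No third derivative of `U` is needed. -/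
theorem abs_symm_diff_le (hU : ContDiff ℝ 2 U) {p v : Plane} {ε : ℝ}
    (h : ∀ q, ‖q - p‖ ≤ ‖v‖ → ‖hess U q - hess U p‖ ≤ ε) :
    |U (p + v) + U (p - v) - 2 * U p - inner ℝ v (hess U p v)| ≤ 2 * ε * ‖v‖ ^ 2 := by
  have hε : 0 ≤ ε := (norm_nonneg _).trans (h p (by simp))
  have hb : ∀ t ∈ Icc (0 : ℝ) 1, ∀ w : Plane, ‖w‖ = ‖v‖ →
      ‖hess U (p + t • w) v - hess U p v‖ ≤ ε * ‖v‖ := by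
    intro t ht w hw
    have := h (p + t • w) (by
      rw [add_sub_cancel_left, norm_smul, hw, Real.norm_of_nonneg ht.1]
      exact mul_le_of_le_one_left (norm_nonneg _) ht.2)
    rw [← sub_apply]
    exact (ContinuousLinearMap.le_opNorm _ _).trans (by gcongr)
  set G : ℝ → Plane := fun t => gradient U (p + t • v) - gradient U (p + t • (-v)) -
    (2 * t) • hess U p v with hG
  have hGd : ∀ t, HasDerivAt G
      (hess U (p + t • v) v - hess U (p + t • (-v)) (-v) - (2 : ℝ) • hess U p v) t := fun t => by
    have h3 : HasDerivAt (fun t : ℝ => (2 * t) • hess U p v) ((2 : ℝ) • hess U p v) t := by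
      simpa using ((hasDerivAt_id t).const_mul 2).smul_const (hess U p v)
    exact ((hasDerivAt_gradient_line hU p v t).sub (hasDerivAt_gradient_line hU p (-v) t)).sub h3
  have hGb : ∀ t ∈ Icc (0 : ℝ) 1, ‖G t‖ ≤ 2 * ε * ‖v‖ := by
    intro t ht
    have := (convex_Icc (0 : ℝ) 1).norm_image_sub_le_of_norm_hasDerivWithin_le (C := 2 * ε * ‖v‖)
      (fun x _ => (hGd x).hasDerivWithinAt) (fun x hx => ?_) (left_mem_Icc.2 zero_le_one) ht
    · have hG0 : G 0 = 0 := by simp [hG]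
      rw [hG0, sub_zero, sub_zero, Real.norm_of_nonneg ht.1] at this
      exact this.trans (mul_le_of_le_one_right (by positivity) ht.2)
    · have e : hess U (p + x • v) v - hess U (p + x • (-v)) (-v) - (2 : ℝ) • hess U p v =
          (hess U (p + x • v) v - hess U p v) + (hess U (p + x • (-v)) v - hess U p v) := by
        rw [map_neg, two_smul]; abel
      rw [e]
      calc _ ≤ _ := norm_add_le _ _
        _ ≤ ε * ‖v‖ + ε * ‖v‖ := add_le_add (hb x hx v rfl) (hb x hx (-v) (norm_neg v))
        _ = _ := by ring
  set k : ℝ → ℝ := fun t => U (p + t • v) + U (p + t • (-v)) - 2 * U p -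
    t ^ 2 * inner ℝ v (hess U p v) with hk
  have hkd : ∀ t, HasDerivAt k (inner ℝ (G t) v) t := fun t => by
    have := (((hasDerivAt_line hU p v t).add (hasDerivAt_line hU p (-v) t)).sub_const
      (2 * U p)).sub (((hasDerivAt_id t).pow 2).mul_const (inner ℝ v (hess U p v)))
    refine this.congr_deriv ?_
    simp only [hG, inner_sub_left, inner_neg_right, real_inner_smul_left, id]
    rw [real_inner_comm v (hess U p v)]
    push_cast
    ring
  have := (convex_Icc (0 : ℝ) 1).norm_image_sub_le_of_norm_hasDerivWithin_le (C := 2 * ε * ‖v‖ ^ 2)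
      (fun x _ => (hkd x).hasDerivWithinAt) (fun x hx => ?_) (left_mem_Icc.2 zero_le_one)
      (right_mem_Icc.2 zero_le_one)
  · have hk0 : k 0 = 0 := by simp [hk]; ring
    have hk1 : k 1 = U (p + v) + U (p - v) - 2 * U p - inner ℝ v (hess U p v) := by
      simp [hk, sub_eq_add_neg]
    rw [hk0, hk1] at this
    simpa using this
  · calc _ ≤ ‖G x‖ * ‖v‖ := norm_inner_le_norm _ _
      _ ≤ 2 * ε * ‖v‖ * ‖v‖ := by gcongr; exact hGb x hx
      _ = _ := by ring

/-- The second symmetric difference is the Hessian form up to `o(‖v‖²)`, uniformly on compacts. -/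
theorem exists_symm_diff_le (hU : ContDiff ℝ 2 U) {K : Set Plane} (hK : IsCompact K) {ε : ℝ}
    (hε : 0 < ε) : ∃ δ > 0, ∀ p ∈ K, ∀ v : Plane, ‖v‖ < δ →
      |U (p + v) + U (p - v) - 2 * U p - inner ℝ v (hess U p v)| ≤ 2 * ε * ‖v‖ ^ 2 := by
  have := hK.uniformContinuousAt_of_continuousAt (hess U)
    (fun a _ => (continuous_hess hU).continuousAt) (Metric.dist_mem_uniformity hε)
  obtain ⟨δ, hδ, h⟩ := Metric.mem_uniformity_dist.1 this
  refine ⟨δ, hδ, fun p hp v hv => abs_symm_diff_le hU fun q hq => ?_⟩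
  have := h (a := p) (b := q) (by rw [dist_comm, dist_eq_norm]; linarith) hp
  rw [← dist_eq_norm, dist_comm]
  exact le_of_lt this

end Hessian

/-! ### Nonnegativity of the second variation at a minimizing profile. -/

section SecondVariation

variable {V : Plane → ℝ} {d R : ℝ} {F : ℝ → Plane}

theorem PotentialAssumptions.nonneg (hV : PotentialAssumptions V) (p : Plane) : 0 ≤ V p := by
  by_cases h1 : p = !₂[1, 0]
  · rw [h1, hV.zero_right]
  by_cases h2 : p = !₂[-1, 0]
  · rw [h2, hV.zero_left]
  exact (hV.pos p h1 h2).le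

theorem shiftedPotential_nonneg (hV : PotentialAssumptions V) (d R : ℝ) (p : Plane) :
    0 ≤ shiftedPotential V d R p :=
  add_nonneg (hV.nonneg p) (by positivity)

theorem contDiff_shiftedPotential (hV : PotentialAssumptions V) (d R : ℝ) :
    ContDiff ℝ 2 (shiftedPotential V d R) :=
  hV.contDiff.add (contDiff_const.mul ((EuclideanSpace.proj (𝕜 := ℝ) (1 : Fin 2)).contDiff.pow 2))

theorem IsProfile.memLp_deriv (hV : PotentialAssumptions V) (hF : IsProfile V d R F) :
    MemLp (deriv F) 2 := by
  have hc : Continuous (deriv F) := hF.contDiff.continuous_deriv (by norm_num)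
  rw [memLp_two_iff_integrable_sq_norm hc.aestronglyMeasurable]
  refine (hF.admissible.finite_energy.const_mul 2).mono'
    (hc.norm.pow 2).aestronglyMeasurable (Eventually.of_forall fun y => ?_)
  rw [Real.norm_of_nonneg (by positivity), energyDensity]
  linarith [shiftedPotential_nonneg hV d R (F y)]

theorem IsProfile.integrable_potential (hV : PotentialAssumptions V) (hF : IsProfile V d R F) :
    Integrable fun y => shiftedPotential V d R (F y) := by
  have h := ((hF.memLp_deriv hV).integrable_norm_pow (by simp)).const_mul (1 / 2)
  refine (hF.admissible.finite_energy.sub h).congr (Eventually.of_forall fun y => ?_)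
  simp [energyDensity]

/-- The difference from the potential along the profile is continuous with compact support. -/
theorem integrable_potential_perturbation (hV : PotentialAssumptions V) (hF : IsProfile V d R F)
    {ξ : ℝ → Plane} (hξ : Continuous ξ) (hc : HasCompactSupport ξ) :
    Integrable fun y => shiftedPotential V d R (F y + ξ y) := by
  have hW := (contDiff_shiftedPotential hV d R).continuous
  have hFc := hF.contDiff.continuous
  have : Integrable fun y => shiftedPotential V d R (F y + ξ y) - shiftedPotential V d R (F y) := by
    refine Continuous.integrable_of_hasCompactSupport (by fun_prop) ?_
    refine hc.mono fun y hy hξ0 => hy ?_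
    simp [hξ0]
  refine (this.add (hF.integrable_potential hV)).congr (Eventually.of_forall fun y => ?_)
  simp

theorem integrable_energyDensity_perturbation (hV : PotentialAssumptions V)
    (hF : IsProfile V d R F) {ξ ξ' : ℝ → Plane} (hξ : Continuous ξ) (hc : HasCompactSupport ξ)
    (hH : MemHOne ξ ξ') :
    Integrable (energyDensity V d R (F + ξ) (deriv F + ξ')) :=
  ((((hF.memLp_deriv hV).add hH.memLp_deriv).integrable_norm_pow (by simp)).const_mul (1 / 2)).add
    (integrable_potential_perturbation hV hF hξ hc)

/-- The constraint `f(0) = 0` is immaterial for compactly supported perturbations of a profile,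
by translation invariance of the energy. -/
theorem IsProfile.energy_le_perturbation (hV : PotentialAssumptions V) (hF : IsProfile V d R F)
    {ξ ξ' : ℝ → Plane} (hξ : Continuous ξ) (hc : HasCompactSupport ξ) (hH : MemHOne ξ ξ') :
    ∫ y, energyDensity V d R F (deriv F) y ≤
      ∫ y, energyDensity V d R (F + ξ) (deriv F + ξ') y := by
  have hint := integrable_energyDensity_perturbation hV hF hξ hc hH
  have hGc : Continuous (F + ξ) := hF.contDiff.continuous.add hξ
  have hG0 : Continuous fun y => (F + ξ) y 0 := (EuclideanSpace.proj (𝕜 := ℝ) 0).continuous.comp hGc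
  have hw : HasWeakDeriv (F + ξ) (deriv F + ξ') := hF.admissible.weak.add hH.weak
  have h0 : Tendsto (fun y => ξ y 0) (cocompact ℝ) (𝓝 0) := by
    have := hc.is_zero_at_infty
    exact ((EuclideanSpace.proj (𝕜 := ℝ) (0 : Fin 2)).continuous.tendsto 0).comp this
  have hr : Tendsto (fun y => (F + ξ) y 0) atTop (𝓝 1) := by
    simpa using hF.admissible.lim_right.add (h0.mono_left atTop_le_cocompact)
  have hl : Tendsto (fun y => (F + ξ) y 0) atBot (𝓝 (-1)) := by
    simpa using hF.admissible.lim_left.add (h0.mono_left atBot_le_cocompact)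
  obtain ⟨a, ha⟩ : ∃ a, (F + ξ) a 0 = 0 := by
    obtain ⟨x, hx⟩ := (hr.eventually (lt_mem_nhds one_pos)).exists
    obtain ⟨z, hz⟩ := (hl.eventually (gt_mem_nhds (neg_one_lt_zero (R := ℝ)))).exists
    exact mem_range_of_exists_le_of_exists_ge hG0 ⟨z, hz.le⟩ ⟨x, hx.le⟩
  have hadm : Admissible V d R (fun y => (F + ξ) (y + a)) (fun y => (deriv F + ξ') (y + a)) :=
    { continuous := hGc.comp (continuous_add_const a)
      weak := hw.comp_add a
      locMemLp_deriv := fun K _ => (((hF.memLp_deriv hV).add hH.memLp_deriv).comp_measurePreserving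
        (measurePreserving_add_right volume a)).restrict K
      finite_energy := hint.comp_add_right a
      zero := by simpa using ha
      lim_right := hr.comp (tendsto_atTop_add_const_right _ a tendsto_id)
      lim_left := hl.comp (tendsto_atBot_add_const_right _ a tendsto_id) }
  refine (hF.minimal _ _ hadm).trans_eq ?_
  exact integral_add_right_eq_self (energyDensity V d R (F + ξ) (deriv F + ξ')) a

/-- The quadratic form `∫ |u'|² + u · A u`. -/
noncomputable def quadForm (A : ℝ → Plane →L[ℝ] Plane) (u u' : ℝ → Plane) : ℝ :=
  ∫ y, (‖u' y‖ ^ 2 + inner ℝ (u y) (A y (u y)))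

/-- Adding the energy inequalities for `F + ξ` and `F - ξ` cancels the first-order terms, so the
Euler–Lagrange equation is not needed. -/
theorem IsProfile.symm_diff_nonneg (hV : PotentialAssumptions V) (hF : IsProfile V d R F)
    {ξ ξ' : ℝ → Plane} (hξ : Continuous ξ) (hc : HasCompactSupport ξ) (hH : MemHOne ξ ξ') :
    0 ≤ ∫ y, (‖ξ' y‖ ^ 2 + (shiftedPotential V d R (F y + ξ y) +
      shiftedPotential V d R (F y - ξ y) - 2 * shiftedPotential V d R (F y))) := by
  have hn : MemHOne (-ξ) (-ξ') := ⟨hH.memLp.neg, hH.memLp_deriv.neg, by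
    simpa using hH.weak.const_smul (-1)⟩
  have hcn : HasCompactSupport (-ξ) := hc.neg
  have e1 := hF.energy_le_perturbation hV hξ hc hH
  have e2 := hF.energy_le_perturbation hV hξ.neg hcn hn
  have i1 := integrable_energyDensity_perturbation hV hF hξ hc hH
  have i2 := integrable_energyDensity_perturbation hV hF hξ.neg hcn hn
  have e3 : ∫ y, (‖ξ' y‖ ^ 2 + (shiftedPotential V d R (F y + ξ y) +
      shiftedPotential V d R (F y - ξ y) - 2 * shiftedPotential V d R (F y))) =
      ∫ y, (energyDensity V d R (F + ξ) (deriv F + ξ') y +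
        energyDensity V d R (F + -ξ) (deriv F + -ξ') y - 2 * energyDensity V d R F (deriv F) y) := by
    congr 1
    ext y
    have := parallelogram_law_with_norm ℝ (deriv F y) (ξ' y)
    simp only [energyDensity, Pi.add_apply, Pi.neg_apply, ← sub_eq_add_neg]
    linarith
  rw [e3, integral_sub (i1.fun_add i2) (hF.admissible.finite_energy.const_mul 2), integral_add i1 i2,
    integral_const_mul]
  linarith

theorem memLp_clm_apply {A : ℝ → Plane →L[ℝ] Plane} (hA : Continuous A) {C : ℝ}
    (hC : ∀ y, ‖A y‖ ≤ C) {u : ℝ → Plane} (hu : MemLp u 2) : MemLp (fun y => A y (u y)) 2 :=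
  hu.of_le_mul (c := C) (ContinuousLinearMap.aestronglyMeasurable_comp₂
    (ContinuousLinearMap.id ℝ (Plane →L[ℝ] Plane)) hA.aestronglyMeasurable hu.1)
    (Eventually.of_forall fun y => (A y).le_of_opNorm_le (hC y) _)

theorem integrable_quadForm {A : ℝ → Plane →L[ℝ] Plane} (hA : Continuous A) {C : ℝ}
    (hC : ∀ y, ‖A y‖ ≤ C) {u u' : ℝ → Plane} (hu : MemLp u 2) (hu' : MemLp u' 2) :
    Integrable fun y => ‖u' y‖ ^ 2 + (inner ℝ (u y) (A y (u y)) : ℝ) :=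
  (hu'.integrable_norm_pow (by simp)).add (memLp_inner_integrable hu (memLp_clm_apply hA hC hu))

theorem exists_norm_le_of_tendsto {E : Type*} [NormedAddCommGroup E] {f : ℝ → E}
    (hf : Continuous f) {a b : E} (ha : Tendsto f atTop (𝓝 a)) (hb : Tendsto f atBot (𝓝 b)) :
    ∃ M, ∀ y, ‖f y‖ ≤ M := by
  obtain ⟨N, hN⟩ := eventually_atTop.1 (ha.norm.eventually (gt_mem_nhds (lt_add_one ‖a‖)))
  obtain ⟨N', hN'⟩ := eventually_atBot.1 (hb.norm.eventually (gt_mem_nhds (lt_add_one ‖b‖)))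
  obtain ⟨M, hM⟩ := (isCompact_Icc (a := N') (b := N)).exists_bound_of_continuousOn hf.continuousOn
  refine ⟨max M (max (‖a‖ + 1) (‖b‖ + 1)), fun y => ?_⟩
  rcases le_total N y with h | h
  · exact (hN y h).le.trans (le_max_of_le_right (le_max_left _ _))
  rcases le_total y N' with h' | h'
  · exact (hN' y h').le.trans (le_max_of_le_right (le_max_right _ _))
  · exact (hM y ⟨h', h⟩).trans (le_max_left _ _)

theorem IsProfile.exists_bound (hF : IsProfile V d R F) : ∃ M, ∀ y, ‖F y‖ ≤ M :=
  exists_norm_le_of_tendsto hF.contDiff.continuous hF.lim_right hF.lim_left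

/-- The Hessian of the shifted potential along a curve. -/
noncomputable def hessAlong (V : Plane → ℝ) (d R : ℝ) (F : ℝ → Plane) (y : ℝ) :
    Plane →L[ℝ] Plane :=
  hess (shiftedPotential V d R) (F y)

theorem IsProfile.continuous_hessAlong (hV : PotentialAssumptions V) (hF : IsProfile V d R F) :
    Continuous (hessAlong V d R F) :=
  (continuous_hess (contDiff_shiftedPotential hV d R)).comp hF.contDiff.continuous

theorem IsProfile.exists_hessAlong_bound (hV : PotentialAssumptions V) (hF : IsProfile V d R F) :
    ∃ C, ∀ y, ‖hessAlong V d R F y‖ ≤ C :=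
  have hh := continuous_hess (contDiff_shiftedPotential hV d R)
  exists_norm_le_of_tendsto (hF.continuous_hessAlong hV) ((hh.tendsto _).comp hF.lim_right)
    ((hh.tendsto _).comp hF.lim_left)

theorem IsProfile.quadForm_nonneg_of_hasCompactSupport (hV : PotentialAssumptions V)
    (hF : IsProfile V d R F) {ξ ξ' : ℝ → Plane} (hξ : Continuous ξ) (hc : HasCompactSupport ξ)
    (hH : MemHOne ξ ξ') : 0 ≤ quadForm (hessAlong V d R F) ξ ξ' := by
  obtain ⟨M, hM⟩ := hF.exists_bound
  obtain ⟨C, hC⟩ := hF.exists_hessAlong_bound hV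
  obtain ⟨B, hB⟩ := hc.exists_bound_of_continuous hξ
  have iq := integrable_quadForm (hF.continuous_hessAlong hV) hC hH.memLp hH.memLp_deriv
  have is := hH.memLp.integrable_norm_pow (p := 2) (by simp)
  have key : ∀ ε : ℝ, 0 < ε →
      0 ≤ quadForm (hessAlong V d R F) ξ ξ' + (2 * ∫ y, ‖ξ y‖ ^ 2) * ε := by
    intro ε hε
    obtain ⟨δ, hδ, h⟩ := exists_symm_diff_le (contDiff_shiftedPotential hV d R)
      (isCompact_closedBall (0 : Plane) M) hε
    -- The amplitude `t` brings `t • ξ` within the range where the symmetric difference is the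
    -- Hessian form up to `2 ε ‖t • ξ‖²`; the common factor `t²` is divided out below, and `ε` tends
    -- to zero at the end.
    obtain ⟨t, ht0, ht⟩ : ∃ t : ℝ, 0 < t ∧ t * B < δ := by
      have hB0 : 0 ≤ B := (norm_nonneg _).trans (hB 0)
      refine ⟨δ / (B + 1), by positivity, ?_⟩
      rw [div_mul_eq_mul_div, div_lt_iff₀ (by positivity)]
      nlinarith
    have hHt : MemHOne (t • ξ) (t • ξ') :=
      ⟨hH.memLp.const_smul t, hH.memLp_deriv.const_smul t, hH.weak.const_smul t⟩
    have hct : HasCompactSupport (t • ξ) := hc.smul_left (f := fun _ => t)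
    have hξt : Continuous (t • ξ) := hξ.const_smul t
    have h1 := hF.symm_diff_nonneg hV hξt hct hHt
    have i1 := integrable_potential_perturbation hV hF hξt hct
    have i2 := integrable_potential_perturbation hV hF hξt.neg hct.neg
    simp only [Pi.neg_apply, ← sub_eq_add_neg] at i2
    have i3 := hF.integrable_potential hV
    have iL := (hHt.memLp_deriv.integrable_norm_pow (p := 2) (by simp)).add
      ((i1.add i2).sub (i3.const_mul 2))
    have iR := (iq.add (is.const_mul (2 * ε))).const_mul (t ^ 2)
    have h2 := integral_mono iL iR fun y => by
      have hn : ‖(t • ξ) y‖ = t * ‖ξ y‖ := by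
        rw [Pi.smul_apply, norm_smul, Real.norm_of_nonneg ht0.le]
      have hn' : ‖(t • ξ') y‖ = t * ‖ξ' y‖ := by
        rw [Pi.smul_apply, norm_smul, Real.norm_of_nonneg ht0.le]
      have := (abs_le.1 (h (F y) (by simpa using hM y) ((t • ξ) y) (by
        rw [hn]
        exact (mul_le_mul_of_nonneg_left (hB y) ht0.le).trans_lt ht))).2
      have hi : (inner ℝ ((t • ξ) y) (hess (shiftedPotential V d R) (F y) ((t • ξ) y)) : ℝ) =
          t ^ 2 * inner ℝ (ξ y) (hessAlong V d R F y (ξ y)) := by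
        rw [Pi.smul_apply, map_smul, real_inner_smul_left, real_inner_smul_right, hessAlong]
        ring
      rw [hi, hn] at this
      simp only [Pi.add_apply, Pi.sub_apply, hn']
      nlinarith
    have h3 := h1.trans h2
    rw [integral_const_mul] at h3
    have h4 := nonneg_of_mul_nonneg_right h3 (by positivity)
    simp only [Pi.add_apply] at h4
    rw [integral_add iq (is.const_mul _), integral_const_mul] at h4
    rw [quadForm]
    linarith
  have hlim : Tendsto (fun ε : ℝ => quadForm (hessAlong V d R F) ξ ξ' +
      (2 * ∫ y, ‖ξ y‖ ^ 2) * ε) (𝓝[>] 0) (𝓝 (quadForm (hessAlong V d R F) ξ ξ')) := by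
    have : Continuous fun ε : ℝ => quadForm (hessAlong V d R F) ξ ξ' +
      (2 * ∫ y, ‖ξ y‖ ^ 2) * ε := by fun_prop
    simpa using (this.tendsto 0).mono_left nhdsWithin_le_nhds
  exact ge_of_tendsto hlim (eventually_nhdsWithin_of_forall key)

theorem quadForm_congr {A : ℝ → Plane →L[ℝ] Plane} {u u' v v' : ℝ → Plane}
    (h : u =ᵐ[volume] v) (h' : u' =ᵐ[volume] v') : quadForm A u u' = quadForm A v v' :=
  integral_congr_ae (by filter_upwards [h, h'] with y h1 h2; rw [h1, h2])

theorem MemHOne.congr {u u' v v' : ℝ → Plane} (h : MemHOne u u') (hu : u =ᵐ[volume] v)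
    (hu' : u' =ᵐ[volume] v') : MemHOne v v' :=
  ⟨(memLp_congr_ae hu).1 h.memLp, (memLp_congr_ae hu').1 h.memLp_deriv, h.weak.congr hu hu'⟩

/-- The second variation of the energy at a profile is nonnegative on `H¹`. -/
theorem IsProfile.quadForm_nonneg (hV : PotentialAssumptions V) (hF : IsProfile V d R F)
    {u u' : ℝ → Plane} (hu : MemHOne u u') : 0 ≤ quadForm (hessAlong V d R F) u u' := by
  obtain ⟨w, hw, huw⟩ := hu.weak.exists_continuous
  rw [quadForm_congr huw (ae_eq_refl u')]
  replace hu := hu.congr huw (ae_eq_refl u')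
  obtain ⟨C, hC⟩ := hF.exists_hessAlong_bound hV
  have hA := hF.continuous_hessAlong hV
  obtain ⟨χ⟩ : Nonempty (ContDiffBump (0 : ℝ)) := inferInstance
  have hχ1 : ContDiff ℝ ∞ (χ : ℝ → ℝ) := χ.contDiff
  have hdc : Continuous (deriv χ) := hχ1.continuous_deriv (by simp)
  obtain ⟨D, hD⟩ := χ.hasCompactSupport.deriv.exists_bound_of_continuous hdc
  -- The cutoffs `χ (s n * y)` spread out to the whole line, while their derivatives carry the
  -- factor `s n` and vanish in the limit.
  set s : ℕ → ℝ := fun n => 1 / ((n : ℝ) + 1) with hs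
  have hs0 : ∀ n, 0 < s n := fun n => Nat.one_div_pos_of_nat
  have hs1 : ∀ n, s n ≤ 1 := fun n => by
    rw [hs]; exact div_le_one_of_le₀ (by simp) (by positivity)
  have hst : Tendsto s atTop (𝓝 0) := tendsto_one_div_add_atTop_nhds_zero_nat
  have hsc : ∀ n, ContDiff ℝ ∞ fun y => χ (s n * y) := fun n =>
    hχ1.comp (contDiff_const.mul contDiff_id)
  have hd : ∀ n y, deriv (fun y => χ (s n * y)) y = s n * deriv χ (s n * y) := fun n y => by
    rw [deriv_comp_mul_left (s n) χ y, smul_eq_mul]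
  have hle : ∀ y, |χ y| ≤ 1 := fun y => by rw [abs_of_nonneg χ.nonneg]; exact χ.le_one
  have hcs : ∀ n, HasCompactSupport fun y => χ (s n * y) := fun n =>
    χ.hasCompactSupport.comp_homeomorph (Homeomorph.mulLeft₀ (s n) (hs0 n).ne')
  have hD0 : 0 ≤ D := (norm_nonneg _).trans (hD 0)
  have hb : ∀ n y, |s n * deriv χ (s n * y)| ≤ D := fun n y => by
    rw [abs_mul, abs_of_pos (hs0 n)]
    exact (mul_le_of_le_one_left (abs_nonneg _) (hs1 n)).trans (hD _)
  have hmem : ∀ n, MemHOne (fun y => χ (s n * y) • w y)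
      (fun y => (s n * deriv χ (s n * y)) • w y + χ (s n * y) • u' y) := fun n => by
    refine ⟨?_, MemLp.add ?_ ?_, ?_⟩
    · exact hu.memLp.of_le_mul (c := 1) ((hsc n).continuous.aestronglyMeasurable.smul hu.memLp.1)
        (Eventually.of_forall fun y => by rw [norm_smul]; gcongr; exact hle _)
    · exact hu.memLp.of_le_mul (c := D) (Continuous.aestronglyMeasurable (by fun_prop))
        (Eventually.of_forall fun y => by rw [norm_smul]; gcongr; exact hb n y)
    · exact hu.memLp_deriv.of_le_mul (c := 1)
        ((hsc n).continuous.aestronglyMeasurable.smul hu.memLp_deriv.1)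
        (Eventually.of_forall fun y => by rw [norm_smul]; gcongr; exact hle _)
    · simpa only [hd] using hu.weak.smooth_smul (hsc n)
  have hnn : ∀ n, 0 ≤ quadForm (hessAlong V d R F) (fun y => χ (s n * y) • w y)
      (fun y => (s n * deriv χ (s n * y)) • w y + χ (s n * y) • u' y) := fun n =>
    hF.quadForm_nonneg_of_hasCompactSupport hV ((hsc n).continuous.smul hw) (hcs n).smul_right
      (hmem n)
  have iw := hu.memLp.integrable_norm_pow (p := 2) (by simp)
  have iw' := hu.memLp_deriv.integrable_norm_pow (p := 2) (by simp)
  suffices lim : Tendsto (fun n => quadForm (hessAlong V d R F) (fun y => χ (s n * y) • w y)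
      (fun y => (s n * deriv χ (s n * y)) • w y + χ (s n * y) • u' y)) atTop
      (𝓝 (quadForm (hessAlong V d R F) w u')) from
    ge_of_tendsto lim (Eventually.of_forall hnn)
  refine tendsto_integral_of_dominated_convergence
    (fun y => (2 * D ^ 2 + C) * ‖w y‖ ^ 2 + 2 * ‖u' y‖ ^ 2)
    (fun n => (integrable_quadForm hA hC (hmem n).memLp (hmem n).memLp_deriv).1)
    ((iw.const_mul _).add (iw'.const_mul _)) (fun n => Eventually.of_forall fun y => ?_)
    (Eventually.of_forall fun y => ?_)
  · have n1 : ‖(s n * deriv χ (s n * y)) • w y + χ (s n * y) • u' y‖ ≤ D * ‖w y‖ + ‖u' y‖ := by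
      refine (norm_add_le _ _).trans ?_
      rw [norm_smul, norm_smul]
      exact add_le_add (by gcongr; exact hb n y) (mul_le_of_le_one_left (norm_nonneg _) (hle _))
    have n2 : ‖χ (s n * y) • w y‖ ≤ ‖w y‖ := by
      rw [norm_smul]; exact mul_le_of_le_one_left (norm_nonneg _) (hle _)
    have n3 : |(inner ℝ (χ (s n * y) • w y) (hessAlong V d R F y (χ (s n * y) • w y)) : ℝ)| ≤
        C * ‖w y‖ ^ 2 := by
      have hC0 : 0 ≤ C := (norm_nonneg _).trans (hC y)
      calc _ ≤ _ := abs_real_inner_le_norm _ _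
        _ ≤ ‖χ (s n * y) • w y‖ * (C * ‖χ (s n * y) • w y‖) := by
          gcongr; exact (hessAlong V d R F y).le_of_opNorm_le (hC y) _
        _ ≤ ‖w y‖ * (C * ‖w y‖) := by gcongr
        _ = _ := by ring
    refine (norm_add_le _ _).trans ?_
    rw [Real.norm_of_nonneg (by positivity), Real.norm_eq_abs]
    have n4 : ‖(s n * deriv χ (s n * y)) • w y + χ (s n * y) • u' y‖ ^ 2 ≤
        (D * ‖w y‖ + ‖u' y‖) ^ 2 := by gcongr
    nlinarith [sq_nonneg (D * ‖w y‖ - ‖u' y‖)]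
  · have ty : Tendsto (fun n => s n * y) atTop (𝓝 0) := by simpa using hst.mul_const y
    have t1 : Tendsto (fun n => χ (s n * y)) atTop (𝓝 1) := by
      have := (hχ1.continuous.tendsto 0).comp ty
      rwa [χ.one_of_mem_closedBall (Metric.mem_closedBall_self χ.rIn_pos.le)] at this
    have t2 : Tendsto (fun n => s n * deriv χ (s n * y)) atTop (𝓝 0) := by
      simpa using hst.mul ((hdc.tendsto 0).comp ty)
    have t3 : Tendsto (fun n => χ (s n * y) • w y) atTop (𝓝 (w y)) := by
      simpa using t1.smul_const (w y)
    have t4 : Tendsto (fun n => (s n * deriv χ (s n * y)) • w y + χ (s n * y) • u' y) atTop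
        (𝓝 (u' y)) := by
      simpa using (t2.smul_const (w y)).add (t1.smul_const (u' y))
    exact (t4.norm.pow 2).add (t3.inner (((hessAlong V d R F y).continuous.tendsto _).comp t3))

end SecondVariation

/-! ### An abstract coercivity criterion. -/

section Abstract

/-- A nonnegative continuous form on a closed subspace that is coercive up to finitely many
functionals and definite is coercive. -/
theorem exists_coercive_of_finite_defect {E ι : Type*} [NormedAddCommGroup E] [NormedSpace ℝ E]
    [CompleteSpace E] [Fintype ι] (B : E →L[ℝ] E →L[ℝ] ℝ) (S : Submodule ℝ E)
    (hS : IsClosed (S : Set E)) (hB : ∀ x ∈ S, 0 ≤ B x x) (ℓ : ι → E →L[ℝ] ℝ) {c K : ℝ}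
    (hc : 0 < c) (hcK : ∀ x ∈ S, c * ‖x‖ ^ 2 ≤ B x x + K * ∑ i, ℓ i x ^ 2)
    (hdef : ∀ x ∈ S, B x x = 0 → x = 0) : ∃ c' > 0, ∀ x ∈ S, c' * ‖x‖ ^ 2 ≤ B x x := by
  by_contra! hcon
  have hx : ∀ n : ℕ, ∃ x ∈ S, ‖x‖ = 1 ∧ B x x < 1 / ((n : ℝ) + 1) := by
    intro n
    obtain ⟨x, hxS, hx⟩ := hcon (1 / ((n : ℝ) + 1)) Nat.one_div_pos_of_nat
    have hx0 : ‖x‖ ≠ 0 := fun h => by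
      rw [norm_eq_zero] at h
      simp [h] at hx
    refine ⟨‖x‖⁻¹ • x, S.smul_mem _ hxS, by rw [norm_smul, norm_inv, norm_norm,
      inv_mul_cancel₀ hx0], ?_⟩
    simp only [map_smul, smul_apply, smul_eq_mul]
    rw [← mul_assoc, ← mul_inv, inv_mul_lt_iff₀ (by positivity)]
    linarith
  choose x hxS hx1 hxB using hx
  have hB0 : Tendsto (fun n => B (x n) (x n)) atTop (𝓝 0) :=
    squeeze_zero (fun n => hB _ (hxS n)) (fun n => (hxB n).le)
      tendsto_one_div_add_atTop_nhds_zero_nat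
  -- The normalized vectors need not have a convergent subsequence a priori, but their finitely many
  -- values under `ℓ` do. The form then upgrades this to norm convergence.
  let L : E →L[ℝ] ι → ℝ := ContinuousLinearMap.pi ℓ
  obtain ⟨a, -, φ, hφ, ha⟩ := tendsto_subseq_of_bounded
    (Metric.isBounded_closedBall (x := (0 : ι → ℝ)) (r := ‖L‖)) (x := fun n => L (x n))
    (fun n => by
      rw [mem_closedBall_zero_iff]
      simpa [hx1 n] using L.le_opNorm (x n))
  set z := fun n => x (φ n) with hz
  have hzB : Tendsto (fun n => B (z n) (z n)) atTop (𝓝 0) := hB0.comp hφ.tendsto_atTop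
  have hzL : ∀ i, Tendsto (fun n => ℓ i (z n)) atTop (𝓝 (a i)) := fun i =>
    (tendsto_pi_nhds.1 ha) i
  -- Parallelogram identity for `B`, dropping the nonnegative term `B (z m + z n) (z m + z n)`.
  have hbound : ∀ m n, c * ‖z m - z n‖ ^ 2 ≤
      2 * B (z m) (z m) + 2 * B (z n) (z n) + K * ∑ i, (ℓ i (z m) - ℓ i (z n)) ^ 2 := by
    intro m n
    have h1 := hcK _ (S.sub_mem (hxS (φ m)) (hxS (φ n)))
    have h2 := hB _ (S.add_mem (hxS (φ m)) (hxS (φ n)))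
    simp only [map_sub, map_add, sub_apply, add_apply] at h1 h2
    simp only [hz]
    linarith
  have hlim : Tendsto (fun p : ℕ × ℕ => 2 * B (z p.1) (z p.1) + 2 * B (z p.2) (z p.2) +
      K * ∑ i, (ℓ i (z p.1) - ℓ i (z p.2)) ^ 2) atTop (𝓝 0) := by
    have f1 : Tendsto (Prod.fst : ℕ × ℕ → ℕ) atTop atTop := by
      rw [← prod_atTop_atTop_eq]; exact tendsto_fst
    have f2 : Tendsto (Prod.snd : ℕ × ℕ → ℕ) atTop atTop := by
      rw [← prod_atTop_atTop_eq]; exact tendsto_snd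
    have := (((hzB.comp f1).const_mul 2).add ((hzB.comp f2).const_mul 2)).add
      ((tendsto_finsetSum Finset.univ fun i _ =>
        (((hzL i).comp f1).sub ((hzL i).comp f2)).pow 2).const_mul K)
    simpa using this
  have hcau : CauchySeq z := by
    rw [Metric.cauchySeq_iff']
    intro ε hε
    have := hlim.eventually (gt_mem_nhds (show 0 < c * ε ^ 2 by positivity))
    obtain ⟨⟨N, N'⟩, hN⟩ := eventually_atTop.1 this
    refine ⟨max N N', fun n hn => ?_⟩
    have h1 := hN (n, max N N') ⟨(le_max_left _ _).trans hn, le_max_right _ _⟩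
    have h2 := (hbound n (max N N')).trans_lt h1
    rw [dist_eq_norm]
    exact lt_of_pow_lt_pow_left₀ 2 hε.le (lt_of_mul_lt_mul_left h2 hc.le)
  obtain ⟨y, hy⟩ := cauchySeq_tendsto_of_complete hcau
  have hyS : y ∈ S := hS.mem_of_tendsto hy (Eventually.of_forall fun n => hxS _)
  have hyB : B y y = 0 := by
    have hcts : Continuous fun w : E => B w w := by fun_prop
    exact tendsto_nhds_unique ((hcts.tendsto y).comp hy) hzB
  have hy1 : ‖y‖ = 1 := tendsto_nhds_unique hy.norm (by simp [hz, hx1])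
  rw [hdef y hyS hyB, norm_zero] at hy1
  exact zero_ne_one hy1

end Abstract

/-! ### Poincaré's inequality on an interval. -/

section Poincare

variable {u u' : ℝ → Plane}

/-- Cauchy–Schwarz, obtained by integrating the square of `(b - a) ‖u'‖ - J`. -/
theorem sq_intervalIntegral_norm_le (hu' : MemLp u' 2) {a b : ℝ} (hab : a < b) :
    (∫ t in a..b, ‖u' t‖) ^ 2 ≤ (b - a) * ∫ t in a..b, ‖u' t‖ ^ 2 := by
  have hl : LocallyIntegrable u' := hu'.locallyIntegrable (by norm_num)
  have i1 : IntervalIntegrable (fun t => ‖u' t‖) volume a b := (hl.intervalIntegrable' a b).norm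
  have i2 : IntervalIntegrable (fun t => ‖u' t‖ ^ 2) volume a b :=
    (hu'.integrable_norm_pow (by simp)).intervalIntegrable
  set J := ∫ t in a..b, ‖u' t‖ with hJ
  have hh : 0 < b - a := sub_pos.2 hab
  have h0 : 0 ≤ ∫ t in a..b, ((b - a) * ‖u' t‖ ^ 2 - (2 * J) * ‖u' t‖ + J ^ 2 / (b - a)) := by
    refine intervalIntegral.integral_nonneg hab.le fun t _ => ?_
    have : (b - a) * ‖u' t‖ ^ 2 - (2 * J) * ‖u' t‖ + J ^ 2 / (b - a) =
        ((b - a) * ‖u' t‖ - J) ^ 2 / (b - a) := by field_simp; ring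
    rw [this]
    positivity
  rw [intervalIntegral.integral_add ((i2.const_mul _).sub (i1.const_mul _))
    intervalIntegrable_const, intervalIntegral.integral_sub (i2.const_mul _) (i1.const_mul _),
    intervalIntegral.integral_const_mul, intervalIntegral.integral_const_mul,
    intervalIntegral.integral_const, smul_eq_mul, mul_div_cancel₀ _ hh.ne', ← hJ] at h0
  nlinarith

/-- A Poincaré inequality on an interval. -/
theorem HasWeakDeriv.poincare (h : HasWeakDeriv u u') (hu' : MemLp u' 2) {a b : ℝ}
    (hab : a < b) :
    ∫ y in a..b, ‖u y‖ ^ 2 ≤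
      2 / (b - a) * ‖∫ y in a..b, u y‖ ^ 2 + 2 * (b - a) ^ 2 * ∫ y in a..b, ‖u' y‖ ^ 2 := by
  obtain ⟨c, hc⟩ := h.ae_eq_primitive
  set w : ℝ → Plane := fun y => c + primitive u' y with hw
  have hwc : Continuous w := continuous_const.add (continuous_primitive h.locInt_deriv)
  have e1 : ∫ y in a..b, ‖u y‖ ^ 2 = ∫ y in a..b, ‖w y‖ ^ 2 :=
    intervalIntegral.integral_congr_ae (hc.mono fun y hy _ => by rw [hy])
  have e2 : ∫ y in a..b, u y = ∫ y in a..b, w y :=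
    intervalIntegral.integral_congr_ae (hc.mono fun y hy _ => hy)
  rw [e1, e2]
  have hh : 0 < b - a := sub_pos.2 hab
  have hJ := sq_intervalIntegral_norm_le hu' hab
  set J := ∫ t in a..b, ‖u' t‖ with hJd
  have hJ0 : 0 ≤ J := intervalIntegral.integral_nonneg hab.le fun _ _ => norm_nonneg _
  set D := ∫ t in a..b, ‖u' t‖ ^ 2 with hD
  set I := ∫ y in a..b, w y with hI
  have hdiff : ∀ x ∈ Icc a b, ∀ y ∈ Icc a b, ‖w y - w x‖ ≤ J := by
    intro x hx y hy
    have : w y - w x = ∫ t in x..y, u' t := by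
      rw [hw]
      simp only [primitive, add_sub_add_left_eq_sub]
      exact intervalIntegral.integral_interval_sub_left (h.locInt_deriv.intervalIntegrable' _ _)
        (h.locInt_deriv.intervalIntegrable' _ _)
    rw [this]
    refine intervalIntegral.norm_integral_le_integral_norm_uIoc.trans ?_
    rw [hJd, intervalIntegral.integral_of_le hab.le]
    refine setIntegral_mono_set ((h.locInt_deriv.intervalIntegrable' a b).norm.1)
      (Eventually.of_forall fun _ => norm_nonneg _) (Eventually.of_forall fun t ht => ?_)
    exact ⟨(le_min hx.1 hy.1).trans_lt ht.1, ht.2.trans (max_le hx.2 hy.2)⟩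
  have hpt : ∀ y ∈ Icc a b, ‖w y‖ ^ 2 ≤ 2 / (b - a) ^ 2 * ‖I‖ ^ 2 + 2 * (b - a) * D := by
    intro y hy
    -- Comparison with the mean: the deviation is the average of differences `w y - w x`, each at
    -- most the total variation `J`.
    have h1 : (b - a) • w y - I = ∫ x in a..b, (w y - w x) := by
      rw [intervalIntegral.integral_sub intervalIntegrable_const
        (hwc.intervalIntegrable _ _), intervalIntegral.integral_const]
    have h2 : ‖(b - a) • w y - I‖ ≤ J * (b - a) := by
      rw [h1]
      refine (intervalIntegral.norm_integral_le_of_norm_le_const fun x hx => ?_).trans_eq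
        (by rw [abs_of_pos hh])
      rw [uIoc_of_le hab.le] at hx
      exact hdiff x (Ioc_subset_Icc_self hx) y hy
    have h3 : (b - a) * ‖w y‖ ≤ ‖I‖ + J * (b - a) := by
      calc (b - a) * ‖w y‖ = ‖(b - a) • w y‖ := by rw [norm_smul, Real.norm_of_nonneg hh.le]
        _ = ‖I + ((b - a) • w y - I)‖ := by rw [add_sub_cancel]
        _ ≤ _ := (norm_add_le _ _).trans (by gcongr)
    have h4 : ((b - a) * ‖w y‖) ^ 2 ≤ (‖I‖ + J * (b - a)) ^ 2 := by gcongr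
    have h5 : (b - a) ^ 2 * ‖w y‖ ^ 2 ≤ 2 * ‖I‖ ^ 2 + 2 * ((b - a) * D) * (b - a) ^ 2 := by
      nlinarith [sq_nonneg (‖I‖ - J * (b - a)), mul_le_mul_of_nonneg_right hJ (sq_nonneg (b - a))]
    have h6 : 2 / (b - a) ^ 2 * ‖I‖ ^ 2 + 2 * (b - a) * D =
        (2 * ‖I‖ ^ 2 + 2 * ((b - a) * D) * (b - a) ^ 2) / (b - a) ^ 2 := by field_simp
    rw [h6, le_div_iff₀ (by positivity)]
    linarith
  calc _ ≤ ∫ y in a..b, (2 / (b - a) ^ 2 * ‖I‖ ^ 2 + 2 * (b - a) * D) :=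
        intervalIntegral.integral_mono_on hab.le ((hwc.norm.pow 2).intervalIntegrable _ _)
          intervalIntegrable_const hpt
    _ = _ := by
        rw [intervalIntegral.integral_const, smul_eq_mul]
        field_simp

end Poincare

/-! ### Coercivity up to finitely many averages. -/

section Coercivity

theorem neg_mul_norm_sq_le_inner {A : Plane →L[ℝ] Plane} {C : ℝ} (hC : ‖A‖ ≤ C) (v : Plane) :
    -C * ‖v‖ ^ 2 ≤ inner ℝ v (A v) := by
  have h1 := neg_le_of_abs_le (abs_real_inner_le_norm v (A v))
  have h2 : ‖v‖ * ‖A v‖ ≤ ‖v‖ * (C * ‖v‖) := by gcongr; exact A.le_of_opNorm_le hC v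
  nlinarith

/-- If `A` is uniformly positive outside a compact interval, then the form of `A` is coercive on
`H¹` up to finitely many averages. -/
theorem exists_quadForm_coercive {A : ℝ → Plane →L[ℝ] Plane} (hA : Continuous A) {C : ℝ}
    (hC : ∀ y, ‖A y‖ ≤ C) {M c₀ : ℝ} (hM : 0 < M) (hc₀ : 0 < c₀)
    (hpos : ∀ y, M ≤ |y| → ∀ v : Plane, c₀ * ‖v‖ ^ 2 ≤ inner ℝ v (A y v)) :
    ∃ (N : ℕ) (a : ℕ → ℝ) (c K : ℝ), Monotone a ∧ 0 < c ∧ ∀ u u' : ℝ → Plane, MemHOne u u' →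
      c * ((∫ y, ‖u y‖ ^ 2) + ∫ y, ‖u' y‖ ^ 2) ≤
        quadForm A u u' + K * ∑ i ∈ Finset.range N, ‖∫ y in a i..a (i + 1), u y‖ ^ 2 := by
  have hC0 : 0 ≤ C := (norm_nonneg _).trans (hC 0)
  -- With `N` pieces of length `h = 2M/N`, the Poincaré term `2h²` times the worst deficit `C + c₀`
  -- absorbs at most half of the kinetic energy.
  obtain ⟨N, hN0, hN⟩ : ∃ N : ℕ, 0 < N ∧ 2 * (2 * M / N) ^ 2 * (C + c₀) ≤ 1 / 2 := by
    have : Tendsto (fun N : ℕ => 2 * (2 * M / N) ^ 2 * (C + c₀)) atTop (𝓝 0) := by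
      have h1 : Tendsto (fun N : ℕ => 2 * M / (N : ℝ)) atTop (𝓝 0) :=
        tendsto_const_div_atTop_nhds_zero_nat _
      simpa using ((h1.pow 2).const_mul 2).mul_const (C + c₀)
    exact ((eventually_gt_atTop 0).and (this.eventually (Iic_mem_nhds (by norm_num)))).exists
  have hN' : (0 : ℝ) < N := by exact_mod_cast hN0
  set h : ℝ := 2 * M / N with hh
  have hh0 : 0 < h := by positivity
  set a : ℕ → ℝ := fun i => -M + i * h with ha
  have hstep : ∀ i, a (i + 1) - a i = h := fun i => by simp only [ha]; push_cast; ring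
  have ha0 : a 0 = -M := by simp [ha]
  have haN : a N = M := by simp only [ha, hh]; field_simp; ring
  refine ⟨N, a, min c₀ (1 / 2), (C + c₀) * (2 / h), ?_, by positivity, fun u u' hu => ?_⟩
  · exact monotone_nat_of_le_succ fun i => by linarith [hstep i]
  have iu := hu.memLp.integrable_norm_pow (p := 2) (by simp)
  have iu' := hu.memLp_deriv.integrable_norm_pow (p := 2) (by simp)
  have iq := integrable_quadForm hA hC hu.memLp hu.memLp_deriv
  have hsum : ∫ y in (-M)..M, ‖u y‖ ^ 2 ≤
      2 / h * (∑ i ∈ Finset.range N, ‖∫ y in a i..a (i + 1), u y‖ ^ 2) +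
        2 * h ^ 2 * ∫ y in (-M)..M, ‖u' y‖ ^ 2 := by
    have t1 := intervalIntegral.sum_integral_adjacent_intervals (a := a) (n := N)
      (f := fun y => ‖u y‖ ^ 2) (μ := volume) fun k _ => iu.intervalIntegrable
    have t2 := intervalIntegral.sum_integral_adjacent_intervals (a := a) (n := N)
      (f := fun y => ‖u' y‖ ^ 2) (μ := volume) fun k _ => iu'.intervalIntegrable
    rw [ha0, haN] at t1 t2
    rw [← t1, ← t2, Finset.mul_sum, Finset.mul_sum, ← Finset.sum_add_distrib]
    refine Finset.sum_le_sum fun i _ => ?_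
    have := hu.weak.poincare hu.memLp_deriv (a := a i) (b := a (i + 1))
      (by linarith [hstep i])
    rwa [hstep] at this
  have hin : ∀ f : ℝ → ℝ, ∫ y in (-M)..M, f y = ∫ y, (Ioc (-M) M).indicator f y := fun f => by
    rw [integral_indicator measurableSet_Ioc, intervalIntegral.integral_of_le (by linarith)]
  have hu'le : ∫ y in (-M)..M, ‖u' y‖ ^ 2 ≤ ∫ y, ‖u' y‖ ^ 2 := by
    rw [intervalIntegral.integral_of_le (by linarith)]
    exact setIntegral_le_integral iu' (Eventually.of_forall fun _ => by positivity)
  -- The lower bound `c₀` is claimed on the whole line and corrected by `C + c₀` on `(-M, M]`, where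
  -- only the bound `-C` is available.
  have hlow : (∫ y, ‖u' y‖ ^ 2) + c₀ * (∫ y, ‖u y‖ ^ 2) -
      (C + c₀) * ∫ y in (-M)..M, ‖u y‖ ^ 2 ≤ quadForm A u u' := by
    have ii : Integrable ((Ioc (-M) M).indicator fun y => ‖u y‖ ^ 2) :=
      iu.indicator measurableSet_Ioc
    rw [hin, ← integral_const_mul, ← integral_const_mul, ← integral_add iu' (iu.const_mul _),
      ← integral_sub (iu'.fun_add (iu.const_mul _)) (ii.const_mul _), quadForm]
    refine integral_mono ((iu'.add (iu.const_mul _)).sub (ii.const_mul _)) iq fun y => ?_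
    simp only
    by_cases hy : y ∈ Ioc (-M) M
    · rw [indicator_of_mem hy]
      linarith [neg_mul_norm_sq_le_inner (hC y) (u y)]
    · rw [indicator_of_notMem hy]
      have : M ≤ |y| := by
        rw [le_abs]
        by_contra! hlt
        exact hy ⟨by linarith, hlt.1.le⟩
      linarith [hpos y this (u y)]
  have hD0 : 0 ≤ ∫ y, ‖u' y‖ ^ 2 := integral_nonneg fun _ => by positivity
  have hU0 : 0 ≤ ∫ y, ‖u y‖ ^ 2 := integral_nonneg fun _ => by positivity
  have h1 := mul_le_mul_of_nonneg_left hsum (by positivity : 0 ≤ C + c₀)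
  have h2 : (C + c₀) * (2 * h ^ 2 * ∫ y in (-M)..M, ‖u' y‖ ^ 2) ≤ 1 / 2 * ∫ y, ‖u' y‖ ^ 2 := by
    calc _ ≤ (C + c₀) * (2 * h ^ 2 * ∫ y, ‖u' y‖ ^ 2) := by gcongr
      _ = 2 * h ^ 2 * (C + c₀) * ∫ y, ‖u' y‖ ^ 2 := by ring
      _ ≤ _ := by gcongr
  have h3 := mul_le_mul_of_nonneg_right (min_le_left c₀ (1 / 2)) hU0
  have h4 := mul_le_mul_of_nonneg_right (min_le_right c₀ (1 / 2)) hD0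
  linarith

end Coercivity

/-! ### Positivity of the shifted Hessian near the wells. -/

section ShiftedHessian

/-- The orthogonal projection onto the `σ`-axis. -/
noncomputable def sigmaProj : Plane →L[ℝ] Plane :=
  (EuclideanSpace.proj (𝕜 := ℝ) (1 : Fin 2)).smulRight (EuclideanSpace.single 1 1)

theorem inner_sigmaProj (v w : Plane) : inner ℝ (sigmaProj v) w = v 1 * w 1 := by
  simp [sigmaProj, real_inner_smul_left, EuclideanSpace.inner_single_left]

variable {V : Plane → ℝ} {d R : ℝ} {F : ℝ → Plane}

theorem gradient_shiftedPotential (hV : PotentialAssumptions V) (d R : ℝ) :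
    gradient (shiftedPotential V d R) = fun p => gradient V p + (d ^ 2 / R ^ 2) • sigmaProj p := by
  ext1 p
  refine HasGradientAt.gradient ?_
  have h1 := ((hV.contDiff.differentiable two_ne_zero p).hasGradientAt).hasFDerivAt
  have h2 := ((((EuclideanSpace.proj (𝕜 := ℝ) (1 : Fin 2)).hasFDerivAt (x := p)).pow 2).const_mul
    (1 / 2 * (d ^ 2 / R ^ 2)))
  refine (h1.add h2).congr_fderiv ?_
  ext v
  simp only [map_add, map_smul, add_apply, smul_apply, InnerProductSpace.toDual_apply_apply,
    inner_sigmaProj, smul_eq_mul, PiLp.proj_apply]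
  ring

theorem hess_shiftedPotential (hV : PotentialAssumptions V) (d R : ℝ) (p : Plane) :
    hess (shiftedPotential V d R) p = hess V p + (d ^ 2 / R ^ 2) • sigmaProj := by
  have h1 := hasFDerivAt_gradient hV.contDiff p
  have h2 := (sigmaProj.hasFDerivAt (x := p)).const_smul (d ^ 2 / R ^ 2)
  rw [hess, gradient_shiftedPotential hV]
  exact (h1.add h2).fderiv

/-- The term added to `V` is convex, so the positivity of `Hess V` at the wells survives for every
`d` and `R`. -/
theorem le_inner_hess_shiftedPotential (hV : PotentialAssumptions V) (d R : ℝ) (p v : Plane) :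
    inner ℝ v (hess V p v) ≤ (inner ℝ v (hess (shiftedPotential V d R) p v) : ℝ) := by
  rw [hess_shiftedPotential hV, add_apply, smul_apply, inner_add_right, real_inner_smul_right,
    real_inner_comm (sigmaProj v) v, inner_sigmaProj]
  have : 0 ≤ d ^ 2 / R ^ 2 * (v 1 * v 1) := mul_nonneg (by positivity) (mul_self_nonneg _)
  linarith

theorem eventually_form_pos {X : Type*} {l : Filter X} {A : X → Plane →L[ℝ] Plane}
    {A₀ : Plane →L[ℝ] Plane} (hA : Tendsto A l (𝓝 A₀)) {lam : ℝ} (hlam : 0 < lam)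
    (h : ∀ v : Plane, lam * ‖v‖ ^ 2 ≤ inner ℝ v (A₀ v)) :
    ∀ᶠ x in l, ∀ v : Plane, lam / 2 * ‖v‖ ^ 2 ≤ inner ℝ v (A x v) := by
  filter_upwards [Metric.tendsto_nhds.1 hA (lam / 2) (half_pos hlam)] with x hx v
  rw [dist_eq_norm] at hx
  have h1 := neg_mul_norm_sq_le_inner hx.le v
  rw [sub_apply, inner_sub_right] at h1
  linarith [h v]

/-- The potential of the linearization is uniformly positive outside a compact interval. -/
theorem IsProfile.exists_hessAlong_pos (hV : PotentialAssumptions V) (hF : IsProfile V d R F) :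
    ∃ M c₀ : ℝ, 0 < M ∧ 0 < c₀ ∧ ∀ y, M ≤ |y| → ∀ v : Plane,
      c₀ * ‖v‖ ^ 2 ≤ inner ℝ v (hessAlong V d R F y v) := by
  obtain ⟨lam, hlam, h⟩ := hV.hess_pos
  have hh := continuous_hess (contDiff_shiftedPotential hV d R)
  have h1 := eventually_form_pos ((hh.tendsto _).comp hF.lim_right) hlam fun v =>
    (h v).1.trans (le_inner_hess_shiftedPotential hV d R _ v)
  have h2 := eventually_form_pos ((hh.tendsto _).comp hF.lim_left) hlam fun v =>
    (h v).2.trans (le_inner_hess_shiftedPotential hV d R _ v)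
  obtain ⟨M, hM⟩ := eventually_atTop.1 h1
  obtain ⟨M', hM'⟩ := eventually_atBot.1 h2
  refine ⟨max 1 (max M (-M')), lam / 2, by positivity, by positivity, fun y hy => ?_⟩
  have hy1 : M ≤ |y| := (le_max_left M (-M')).trans ((le_max_right _ _).trans hy)
  have hy2 : -M' ≤ |y| := (le_max_right M (-M')).trans ((le_max_right _ _).trans hy)
  rcases le_total 0 y with h0 | h0
  · rw [abs_of_nonneg h0] at hy1
    exact hM y hy1
  · rw [abs_of_nonpos h0] at hy2
    exact hM' y (by linarith)

end ShiftedHessian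

/-! ### `H¹` as a closed subspace of `L² × L²`, and null vectors of the form. -/

section HilbertSetting

/-- The space `L²(ℝ; ℝ²)`. -/
abbrev PlaneL2 : Type := Lp Plane 2 (volume : Measure ℝ)

theorem memLp_smul_const {φ : ℝ → ℝ} (hφ : Continuous φ) (hc : HasCompactSupport φ) (e : Plane) :
    MemLp (fun y => φ y • e) 2 (volume : Measure ℝ) :=
  (hφ.smul continuous_const).memLp_of_hasCompactSupport hc.smul_right

theorem inner_integral_smul {φ : ℝ → ℝ} (hφ : Continuous φ) (hc : HasCompactSupport φ) (e : Plane)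
    {u : ℝ → Plane} (hu : LocallyIntegrable u) :
    inner ℝ e (∫ y, φ y • u y) = ∫ y, (inner ℝ (φ y • e) (u y) : ℝ) := by
  rw [← integral_inner (integrable_smul_of_smooth hu hφ hc)]
  simp only [real_inner_smul_left, real_inner_smul_right]

theorem inner_toLp {u v : ℝ → Plane} (hu : MemLp u 2) (hv : MemLp v 2) :
    (inner ℝ (hu.toLp u : PlaneL2) (hv.toLp v) : ℝ) = ∫ y, (inner ℝ (u y) (v y) : ℝ) := by
  rw [L2.inner_def]
  refine integral_congr_ae ?_
  filter_upwards [hu.coeFn_toLp, hv.coeFn_toLp] with y h1 h2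
  rw [h1, h2]

theorem norm_sq_toLp {u : ℝ → Plane} (hu : MemLp u 2) :
    ‖(hu.toLp u : PlaneL2)‖ ^ 2 = ∫ y, ‖u y‖ ^ 2 := by
  rw [← real_inner_self_eq_norm_sq, inner_toLp]
  simp only [real_inner_self_eq_norm_sq]

/-- `H¹(ℝ; ℝ²)` as a subspace of pairs `(u, u')`. -/
def sobolevOne : Submodule ℝ (PlaneL2 × PlaneL2) where
  carrier := {x | HasWeakDeriv x.1 x.2}
  add_mem' {x y} hx hy := (hx.add hy).congr (Lp.coeFn_add x.1 y.1).symm (Lp.coeFn_add x.2 y.2).symm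
  zero_mem' := by
    refine (hasWeakDeriv_of_contDiff (f := 0) contDiff_const).congr
      (Lp.coeFn_zero Plane 2 volume).symm ?_
    rw [show deriv (0 : ℝ → Plane) = 0 from deriv_const' 0]
    exact (Lp.coeFn_zero Plane 2 volume).symm
  smul_mem' c x hx := (hx.const_smul c).congr (Lp.coeFn_smul c x.1).symm (Lp.coeFn_smul c x.2).symm

theorem MemHOne.toLp_mem {u u' : ℝ → Plane} (h : MemHOne u u') :
    ((h.memLp.toLp u, h.memLp_deriv.toLp u') : PlaneL2 × PlaneL2) ∈ sobolevOne :=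
  h.weak.congr h.memLp.coeFn_toLp.symm h.memLp_deriv.coeFn_toLp.symm

theorem memHOne_of_mem {x : PlaneL2 × PlaneL2} (hx : x ∈ sobolevOne) : MemHOne x.1 x.2 :=
  ⟨Lp.memLp x.1, Lp.memLp x.2, hx⟩

/-- Tested against the functions `φ • e`, the weak derivative relation is a family of continuous
linear equations on `L² × L²`. -/
theorem isClosed_sobolevOne : IsClosed (sobolevOne : Set (PlaneL2 × PlaneL2)) := by
  have : (sobolevOne : Set (PlaneL2 × PlaneL2)) =
      ⋂ (φ : ℝ → ℝ) (hφ : ContDiff ℝ ∞ φ) (hc : HasCompactSupport φ) (e : Plane),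
        {x | (inner ℝ ((memLp_smul_const (hφ.continuous_deriv (by simp)) hc.deriv e).toLp _) x.1 : ℝ)
          = -inner ℝ ((memLp_smul_const hφ.continuous hc e).toLp _) x.2} := by
    have loc : ∀ f : PlaneL2, LocallyIntegrable f volume := fun f =>
      (Lp.memLp f).locallyIntegrable (by norm_num)
    have key : ∀ (φ : ℝ → ℝ) (hφ : Continuous φ) (hc : HasCompactSupport φ) (e : Plane)
        (f : PlaneL2), (inner ℝ ((memLp_smul_const hφ hc e).toLp _) f : ℝ) =
          inner ℝ e (∫ y, φ y • f y) := by
      intro φ hφ hc e f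
      rw [inner_integral_smul hφ hc e (loc f), ← inner_toLp (memLp_smul_const hφ hc e) (Lp.memLp f),
        Lp.toLp_coeFn]
    ext x
    simp only [mem_iInter, mem_ofPred_eq, SetLike.mem_coe]
    constructor
    · intro hx φ hφ hc e
      rw [key _ (hφ.continuous_deriv (by simp)) hc.deriv, key _ hφ.continuous hc,
        HasWeakDeriv.by_parts hx φ hφ hc, inner_neg_right]
    · intro hx
      refine ⟨loc _, loc _, fun φ hφ hc => ext_inner_left ℝ fun e => ?_⟩
      rw [inner_neg_right, ← key _ (hφ.continuous_deriv (by simp)) hc.deriv,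
        ← key _ hφ.continuous hc, hx φ hφ hc e]
  rw [this]
  refine isClosed_iInter fun φ => isClosed_iInter fun hφ => isClosed_iInter fun hc =>
    isClosed_iInter fun e => isClosed_eq ?_ ?_ <;> fun_prop

/-- Multiplication by a bounded continuous matrix function on `L²`. -/
noncomputable def mulOp {A : ℝ → Plane →L[ℝ] Plane} (hA : Continuous A) {C : ℝ}
    (hC : ∀ y, ‖A y‖ ≤ C) : PlaneL2 →L[ℝ] PlaneL2 :=
  LinearMap.mkContinuous
    { toFun := fun f => (memLp_clm_apply hA hC (Lp.memLp f)).toLp _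
      map_add' := fun f g => by
        rw [← MemLp.toLp_add]
        refine MemLp.toLp_congr _ _ ((Lp.coeFn_add f g).mono fun y hy => ?_)
        simp only [hy, Pi.add_apply, map_add]
      map_smul' := fun c f => by
        rw [RingHom.id_apply, ← MemLp.toLp_const_smul]
        refine MemLp.toLp_congr _ _ ((Lp.coeFn_smul c f).mono fun y hy => ?_)
        simp only [hy, Pi.smul_apply, map_smul] }
    C fun f => by
      refine Lp.norm_le_mul_norm_of_ae_le_mul ?_
      filter_upwards [(memLp_clm_apply hA hC (Lp.memLp f)).coeFn_toLp] with y hy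
      simp only [LinearMap.coe_mk, AddHom.coe_mk, hy]
      exact (A y).le_of_opNorm_le (hC y) _

/-- The bilinear form `∫ u' · v' + u · A v` on pairs `(u, u')`, `(v, v')`. -/
noncomputable def bilinForm {A : ℝ → Plane →L[ℝ] Plane} (hA : Continuous A) {C : ℝ}
    (hC : ∀ y, ‖A y‖ ≤ C) : (PlaneL2 × PlaneL2) →L[ℝ] (PlaneL2 × PlaneL2) →L[ℝ] ℝ :=
  (innerSL ℝ).bilinearComp (ContinuousLinearMap.snd ℝ PlaneL2 PlaneL2)
      (ContinuousLinearMap.snd ℝ PlaneL2 PlaneL2) +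
    (innerSL ℝ).bilinearComp (ContinuousLinearMap.fst ℝ PlaneL2 PlaneL2)
      ((mulOp hA hC).comp (ContinuousLinearMap.fst ℝ PlaneL2 PlaneL2))

variable {A : ℝ → Plane →L[ℝ] Plane} (hA : Continuous A) {C : ℝ} (hC : ∀ y, ‖A y‖ ≤ C)

theorem bilinForm_eq (x y : PlaneL2 × PlaneL2) :
    bilinForm hA hC x y = ∫ t, (inner ℝ (x.2 t) (y.2 t) + inner ℝ (x.1 t) (A t (y.1 t))) := by
  have e : bilinForm hA hC x y = inner ℝ x.2 y.2 + inner ℝ x.1 (mulOp hA hC y.1) := rfl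
  rw [e, L2.inner_def, L2.inner_def, ← integral_add (L2.integrable_inner _ _)
    (L2.integrable_inner _ _)]
  refine integral_congr_ae ?_
  filter_upwards [(memLp_clm_apply hA hC (Lp.memLp y.1)).coeFn_toLp] with t ht
  rw [show (mulOp hA hC y.1) t = A t (y.1 t) from ht]

theorem bilinForm_self (x : PlaneL2 × PlaneL2) :
    bilinForm hA hC x x = quadForm A x.1 x.2 := by
  rw [bilinForm_eq, quadForm]
  simp only [real_inner_self_eq_norm_sq]

theorem bilinForm_comm (hs : ∀ t v w, inner ℝ (A t v) w = (inner ℝ v (A t w) : ℝ))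
    (x y : PlaneL2 × PlaneL2) : bilinForm hA hC x y = bilinForm hA hC y x := by
  rw [bilinForm_eq, bilinForm_eq]
  congr 1
  ext t
  rw [real_inner_comm, ← hs, real_inner_comm (y.1 t)]

/-- Degenerate directions of a nonnegative form on `H¹` are orthogonal to `H¹` for the form. -/
theorem bilinForm_eq_zero (hs : ∀ t v w, inner ℝ (A t v) w = (inner ℝ v (A t w) : ℝ))
    (hnn : ∀ u u' : ℝ → Plane, MemHOne u u' → 0 ≤ quadForm A u u')
    {x : PlaneL2 × PlaneL2} (hx : x ∈ sobolevOne) (hx0 : quadForm A x.1 x.2 = 0)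
    {y : PlaneL2 × PlaneL2} (hy : y ∈ sobolevOne) : bilinForm hA hC x y = 0 := by
  -- Nonnegativity of the form at `x + t y` is a quadratic in `t` without constant term; its
  -- discriminant forces the linear coefficient to vanish.
  have hq : ∀ t : ℝ, 0 ≤ bilinForm hA hC y y * (t * t) + 2 * bilinForm hA hC x y * t + 0 := by
    intro t
    have h1 := hnn _ _ (memHOne_of_mem (sobolevOne.add_mem hx (sobolevOne.smul_mem t hy)))
    rw [← bilinForm_self hA hC] at h1
    simp only [map_add, map_smul, add_apply, smul_apply, smul_eq_mul] at h1
    rw [bilinForm_self hA hC x, hx0, bilinForm_comm hA hC hs y x] at h1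
    linarith
  have := discrim_le_zero hq
  rw [discrim] at this
  nlinarith [sq_nonneg (bilinForm hA hC x y)]

/-- Degenerate directions of a nonnegative form on `H¹` solve the linear equation. -/
theorem MemHTwo.of_quadForm_eq_zero (hA : Continuous A) (hC : ∀ y, ‖A y‖ ≤ C)
    (hs : ∀ t v w, inner ℝ (A t v) w = (inner ℝ v (A t w) : ℝ))
    (hnn : ∀ u u' : ℝ → Plane, MemHOne u u' → 0 ≤ quadForm A u u')
    {x : PlaneL2 × PlaneL2} (hx : x ∈ sobolevOne) (hx0 : quadForm A x.1 x.2 = 0) :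
    MemHTwo x.1 x.2 (fun t => A t (x.1 t)) := by
  have hxH := memHOne_of_mem hx
  have horth : ∀ y ∈ sobolevOne, bilinForm hA hC x y = 0 := fun y hy =>
    bilinForm_eq_zero hA hC hs hnn hx hx0 hy
  refine ⟨hxH, hxH.memLp_deriv, memLp_clm_apply hA hC hxH.memLp, hxH.weak.locInt_deriv,
    (memLp_clm_apply hA hC hxH.memLp).locallyIntegrable (by norm_num), fun φ hφ hc => ?_⟩
  have hAl := (memLp_clm_apply hA hC hxH.memLp).locallyIntegrable (by norm_num)
  have hdφ : Continuous (deriv φ) := hφ.continuous_deriv (by simp)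
  refine ext_inner_left ℝ fun e => ?_
  have hd : deriv (fun y => φ y • e) = fun y => deriv φ y • e := funext fun y =>
    ((hφ.differentiable (by simp) y).hasDerivAt.smul_const e).deriv
  have hw := hasWeakDeriv_of_contDiff (f := fun y => φ y • e)
    ((hφ.of_le (by simp)).smul contDiff_const)
  rw [hd] at hw
  have m1 := memLp_smul_const hφ.continuous hc e
  have m2 := memLp_smul_const hdφ hc.deriv e
  have h0 := horth _ (MemHOne.toLp_mem ⟨m1, m2, hw⟩)
  rw [bilinForm_comm hA hC hs, bilinForm_eq] at h0
  have h1 : ∫ t, ((inner ℝ (deriv φ t • e) (x.2 t) : ℝ) + inner ℝ (φ t • e) (A t (x.1 t))) = 0 := by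
    rw [← h0]
    refine integral_congr_ae ?_
    filter_upwards [m1.coeFn_toLp, m2.coeFn_toLp] with t h1 h2
    rw [h1, h2]
  rw [integral_add (memLp_inner_integrable m2 hxH.memLp_deriv)
    (memLp_inner_integrable m1 (memLp_clm_apply hA hC hxH.memLp)),
    ← inner_integral_smul hdφ hc.deriv e hxH.weak.locInt_deriv,
    ← inner_integral_smul hφ.continuous hc e hAl] at h1
  rw [inner_neg_right]
  linarith

end HilbertSetting

/-! ### Spectral gaps and their stability. -/

section Gap

variable {A A' : ℝ → Plane →L[ℝ] Plane}

/-- The form of `A` is bounded below by `c` on the orthogonal complement of `f` in `H¹`. -/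
def HasGap (A : ℝ → Plane →L[ℝ] Plane) (f : PlaneL2) (c : ℝ) : Prop :=
  ∀ x ∈ sobolevOne, inner ℝ x.1 f = (0 : ℝ) → c * ‖x.1‖ ^ 2 ≤ quadForm A x.1 x.2

theorem norm_sq_eq_integral (f : PlaneL2) : ‖f‖ ^ 2 = ∫ y, ‖f y‖ ^ 2 := by
  rw [← norm_sq_toLp (Lp.memLp f), Lp.toLp_coeFn]

/-- The abstract criterion applies to `H¹ ∩ f^⊥`, with the coordinates of the interval averages as
defect functionals; these are continuous on `L²` as inner products with indicators. -/
theorem exists_hasGap (hA : Continuous A) {C : ℝ} (hC : ∀ y, ‖A y‖ ≤ C)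
    (hnn : ∀ u u' : ℝ → Plane, MemHOne u u' → 0 ≤ quadForm A u u') {M c₀ : ℝ} (hM : 0 < M)
    (hc₀ : 0 < c₀) (hpos : ∀ y, M ≤ |y| → ∀ v : Plane, c₀ * ‖v‖ ^ 2 ≤ inner ℝ v (A y v))
    (f : PlaneL2) (hdef : ∀ x ∈ sobolevOne, inner ℝ x.1 f = (0 : ℝ) → quadForm A x.1 x.2 = 0 →
      x = 0) : ∃ c > 0, HasGap A f c := by
  obtain ⟨N, a, c, K, ha, hc, hcK⟩ := exists_quadForm_coercive hA hC hM hc₀ hpos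
  set p : PlaneL2 × PlaneL2 →L[ℝ] PlaneL2 := ContinuousLinearMap.fst ℝ PlaneL2 PlaneL2
  set q : PlaneL2 × PlaneL2 →L[ℝ] ℝ := (innerSL ℝ f).comp p
  set S : Submodule ℝ (PlaneL2 × PlaneL2) := sobolevOne ⊓ q.ker with hS
  have hSc : IsClosed (S : Set (PlaneL2 × PlaneL2)) := by
    rw [hS, Submodule.coe_inf]
    exact isClosed_sobolevOne.inter q.isClosed_ker
  have hSm : ∀ x, x ∈ S ↔ x ∈ sobolevOne ∧ inner ℝ x.1 f = (0 : ℝ) := fun x => by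
    rw [hS, Submodule.mem_inf, real_inner_comm]
    exact Iff.rfl
  have hfin : ∀ i : Fin N, volume (Ioc (a i) (a (i + 1))) ≠ ⊤ := fun i => by simp
  set ℓ : Fin N × Fin 2 → PlaneL2 × PlaneL2 →L[ℝ] ℝ := fun k =>
    (innerSL ℝ (indicatorConstLp 2 measurableSet_Ioc (hfin k.1)
      (EuclideanSpace.single k.2 (1 : ℝ)))).comp p with hℓ
  have hℓx : ∀ (x : PlaneL2 × PlaneL2) i j,
      ℓ (i, j) x = (∫ y in a i..a (i + 1), x.1 y) j := fun x i j => by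
    have : ℓ (i, j) x = inner ℝ (indicatorConstLp 2 measurableSet_Ioc (hfin i)
      (EuclideanSpace.single j (1 : ℝ))) x.1 := rfl
    rw [this, L2.inner_indicatorConstLp_eq_inner_setIntegral,
      intervalIntegral.integral_of_le (ha (Nat.le_succ _))]
    simp [EuclideanSpace.inner_single_left]
  obtain ⟨c', hc', h⟩ := exists_coercive_of_finite_defect (bilinForm hA hC) S hSc
    (fun x hx => by
      rw [bilinForm_self]
      exact hnn _ _ (memHOne_of_mem ((hSm x).1 hx).1)) ℓ (K := K) hc
    (fun x hx => by
      have h1 := hcK _ _ (memHOne_of_mem ((hSm x).1 hx).1)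
      rw [← norm_sq_eq_integral, ← norm_sq_eq_integral] at h1
      have h2 : ∑ k, ℓ k x ^ 2 = ∑ i ∈ Finset.range N, ‖∫ y in a i..a (i + 1), x.1 y‖ ^ 2 := by
        rw [Fintype.sum_prod_type, Finset.sum_range]
        refine Finset.sum_congr rfl fun i _ => ?_
        rw [EuclideanSpace.norm_sq_eq]
        simp only [hℓx, Real.norm_eq_abs, sq_abs]
      rw [bilinForm_self, h2]
      refine le_trans ?_ h1
      gcongr
      -- The norm of the product is the maximum of the two `L²` norms, so its square is at most
      -- their sum of squares.
      rw [Prod.norm_def]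
      rcases max_cases ‖x.1‖ ‖x.2‖ with h | h <;> rw [h.1] <;>
        nlinarith [sq_nonneg ‖x.1‖, sq_nonneg ‖x.2‖])
    (fun x hx hx0 => hdef x ((hSm x).1 hx).1 ((hSm x).1 hx).2 (by rwa [bilinForm_self] at hx0))
  refine ⟨c', hc', fun x hx hxf => ?_⟩
  rw [← bilinForm_self hA hC]
  refine le_trans ?_ (h x ((hSm x).2 ⟨hx, hxf⟩))
  gcongr
  exact norm_fst_le x

theorem quadForm_sub_le (hA : Continuous A) {C : ℝ} (hC : ∀ y, ‖A y‖ ≤ C) (hA' : Continuous A')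
    {C' : ℝ} (hC' : ∀ y, ‖A' y‖ ≤ C') {δ : ℝ} (hδ : ∀ y, ‖A' y - A y‖ ≤ δ)
    (x : PlaneL2 × PlaneL2) :
    quadForm A x.1 x.2 - δ * ‖x.1‖ ^ 2 ≤ quadForm A' x.1 x.2 := by
  have i1 := integrable_quadForm hA hC (Lp.memLp x.1) (Lp.memLp x.2)
  have i2 := integrable_quadForm hA' hC' (Lp.memLp x.1) (Lp.memLp x.2)
  have i3 := ((Lp.memLp x.1).integrable_norm_pow (p := 2) (by simp)).const_mul δ
  rw [norm_sq_eq_integral, ← integral_const_mul, quadForm, ← integral_sub i1 i3]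
  refine integral_mono (i1.sub i3) i2 fun y => ?_
  have := neg_mul_norm_sq_le_inner (hδ y) (x.1 y)
  rw [sub_apply, inner_sub_right] at this
  simp only
  linarith

/-- A spectral gap above a degenerate direction persists, with almost the same constant, for a
nearby form that has a degenerate direction as well. -/
theorem HasGap.perturb (hA : Continuous A) {C : ℝ} (hC : ∀ y, ‖A y‖ ≤ C) (hA' : Continuous A')
    {C' : ℝ} (hC' : ∀ y, ‖A' y‖ ≤ C') {δ : ℝ} (hδ : ∀ y, ‖A' y - A y‖ ≤ δ)
    (hs : ∀ t v w, inner ℝ (A t v) w = (inner ℝ v (A t w) : ℝ))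
    (hnn : ∀ u u' : ℝ → Plane, MemHOne u u' → 0 ≤ quadForm A u u')
    {X Y : PlaneL2 × PlaneL2} (hX : X ∈ sobolevOne) (hX0 : X.1 ≠ 0)
    (hAX : quadForm A X.1 X.2 = 0) (hY : Y ∈ sobolevOne) (hY0 : Y.1 ≠ 0)
    (hAY : quadForm A' Y.1 Y.2 = 0) {c : ℝ} (hc : 0 < c) (hgap : HasGap A X.1 c) :
    HasGap A' Y.1 (c - 2 * δ) := by
  have hf : 0 < ‖X.1‖ ^ 2 := by positivity
  have hg : 0 < ‖Y.1‖ ^ 2 := by positivity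
  -- Subtracting the component along the null vector `X` leaves the form of `A` unchanged, so the
  -- gap bounds it by the distance to the line of `X`. Clearing the denominator `‖X.1‖²` gives this
  -- shape.
  have star : ∀ x ∈ sobolevOne, c * (‖x.1‖ ^ 2 * ‖X.1‖ ^ 2 - (inner ℝ x.1 X.1 : ℝ) ^ 2) ≤
      ‖X.1‖ ^ 2 * quadForm A x.1 x.2 := by
    intro x hx
    set s : ℝ := (inner ℝ x.1 X.1 : ℝ) / ‖X.1‖ ^ 2 with hsd
    have hmem : x + (-s) • X ∈ sobolevOne := sobolevOne.add_mem hx (sobolevOne.smul_mem _ hX)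
    have e1 : (x + (-s) • X).1 = x.1 + (-s) • X.1 := rfl
    have hin : (inner ℝ (x + (-s) • X).1 X.1 : ℝ) = 0 := by
      rw [e1, inner_add_left, real_inner_smul_left, real_inner_self_eq_norm_sq, hsd]
      field_simp
      ring
    have h1 := hgap _ hmem hin
    have h2 : quadForm A (x + (-s) • X).1 (x + (-s) • X).2 = quadForm A x.1 x.2 := by
      rw [← bilinForm_self hA hC, ← bilinForm_self hA hC]
      simp only [map_add, map_smul, add_apply, smul_apply, smul_eq_mul]
      rw [bilinForm_comm hA hC hs x X, bilinForm_eq_zero hA hC hs hnn hX hAX hx,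
        bilinForm_eq_zero hA hC hs hnn hX hAX hX]
      ring
    have h3 : ‖X.1‖ ^ 2 * ‖(x + (-s) • X).1‖ ^ 2 =
        ‖x.1‖ ^ 2 * ‖X.1‖ ^ 2 - (inner ℝ x.1 X.1 : ℝ) ^ 2 := by
      rw [e1, norm_add_sq_real, norm_smul, real_inner_smul_right, mul_pow, Real.norm_eq_abs, sq_abs,
        hsd]
      field_simp
      ring
    rw [h2] at h1
    rw [← h3]
    nlinarith [mul_le_mul_of_nonneg_left h1 hf.le]
  have hYs := star Y hY
  have hYA := quadForm_sub_le hA hC hA' hC' hδ Y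
  rw [hAY] at hYA
  intro x hx hxY
  have hxs := star x hx
  have hxA := quadForm_sub_le hA hC hA' hC' hδ x
  set m : ℝ := inner ℝ X.1 Y.1 with hm
  -- Since `x ⊥ Y`, only the part of `X` orthogonal to `Y` contributes to `⟨x, X⟩`.
  have hbessel : (inner ℝ x.1 X.1 : ℝ) ^ 2 * ‖Y.1‖ ^ 2 ≤
      ‖x.1‖ ^ 2 * (‖X.1‖ ^ 2 * ‖Y.1‖ ^ 2 - m ^ 2) := by
    set r : PlaneL2 := X.1 + (-(m / ‖Y.1‖ ^ 2)) • Y.1 with hr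
    have h1 : (inner ℝ x.1 r : ℝ) = inner ℝ x.1 X.1 := by
      rw [hr, inner_add_right, real_inner_smul_right, hxY, mul_zero, add_zero]
    have h2 : ‖r‖ ^ 2 * ‖Y.1‖ ^ 2 = ‖X.1‖ ^ 2 * ‖Y.1‖ ^ 2 - m ^ 2 := by
      rw [hr, norm_add_sq_real, norm_smul, real_inner_smul_right, mul_pow, Real.norm_eq_abs, sq_abs,
        ← hm]
      field_simp
      ring
    have h3 : (inner ℝ x.1 r : ℝ) ^ 2 ≤ (‖x.1‖ * ‖r‖) ^ 2 := sq_le_sq.2 <| by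
      rw [abs_of_nonneg (by positivity : 0 ≤ ‖x.1‖ * ‖r‖)]
      exact abs_real_inner_le_norm _ _
    rw [← h1, ← h2]
    nlinarith [mul_le_mul_of_nonneg_right h3 hg.le]
  rw [real_inner_comm, ← hm] at hYs
  -- `Y` is null for `A'`, hence has `A`-form at most `δ ‖Y.1‖²`; by `star` it is nearly parallel to
  -- `X`. This costs one `δ`, and passing from `A` to `A'` at `x` costs the other.
  have h4 : c * (‖X.1‖ ^ 2 * ‖Y.1‖ ^ 2 - m ^ 2) ≤ ‖X.1‖ ^ 2 * (δ * ‖Y.1‖ ^ 2) := by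
    nlinarith [mul_le_mul_of_nonneg_left hYA hf.le]
  have h5 : c * (inner ℝ x.1 X.1 : ℝ) ^ 2 ≤ ‖x.1‖ ^ 2 * ‖X.1‖ ^ 2 * δ := by
    refine le_of_mul_le_mul_right ?_ hg
    calc _ = c * ((inner ℝ x.1 X.1 : ℝ) ^ 2 * ‖Y.1‖ ^ 2) := by ring
      _ ≤ c * (‖x.1‖ ^ 2 * (‖X.1‖ ^ 2 * ‖Y.1‖ ^ 2 - m ^ 2)) := by gcongr
      _ = ‖x.1‖ ^ 2 * (c * (‖X.1‖ ^ 2 * ‖Y.1‖ ^ 2 - m ^ 2)) := by ring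
      _ ≤ ‖x.1‖ ^ 2 * (‖X.1‖ ^ 2 * (δ * ‖Y.1‖ ^ 2)) := by gcongr
      _ = _ := by ring
  have h6 : (c - δ) * ‖x.1‖ ^ 2 ≤ quadForm A x.1 x.2 := by
    refine le_of_mul_le_mul_left ?_ hf
    linarith
  linarith

end Gap

/-! ### The gap for a single profile, and continuity of its Hessian in `R`. -/

section ProfileGap

variable {V : Plane → ℝ} {d R : ℝ} {F : ℝ → Plane}

theorem hessAlong_symm (hV : PotentialAssumptions V) (t : ℝ) (v w : Plane) :
    inner ℝ (hessAlong V d R F t v) w = (inner ℝ v (hessAlong V d R F t w) : ℝ) :=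
  hess_symm (contDiff_shiftedPotential hV d R) _ _ _

/-- Otherwise the profile would be constant, although its limits at the two ends differ. -/
theorem IsProfile.toLp_deriv_ne_zero (hV : PotentialAssumptions V) (hF : IsProfile V d R F) :
    (hF.memLp_deriv hV).toLp (deriv F) ≠ 0 := by
  intro h
  have hae : deriv F =ᵐ[volume] 0 := by
    have := (hF.memLp_deriv hV).coeFn_toLp
    rw [h] at this
    exact this.symm.trans (Lp.coeFn_zero ..)
  have hc : Continuous (deriv F) := hF.contDiff.continuous_deriv (by norm_num)
  have h0 : deriv F = 0 := (hc.ae_eq_iff_eq volume continuous_zero).1 hae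
  have hconst : ∀ y, F y = F 0 := fun y =>
    is_const_of_deriv_eq_zero (hF.contDiff.differentiable two_ne_zero) (fun z => by rw [h0]; rfl) _ _
  have hl : ∀ {l : Filter ℝ} [l.NeBot] {p : Plane}, Tendsto F l (𝓝 p) → p = F 0 := fun h =>
    tendsto_nhds_unique h (tendsto_const_nhds.congr fun y => (hconst y).symm)
  have := congrArg (fun p : Plane => p 0) ((hl hF.lim_right).trans (hl hF.lim_left).symm)
  simp at this
  norm_num at this

theorem linOp_one (V : Plane → ℝ) (d R : ℝ) (F u u'' : ℝ → Plane) (y : ℝ) :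
    linOp V d R 1 F u u'' y = -u'' y + hessAlong V d R F y (u y) := by
  simp [linOp, hessAlong]

/-- If the profile is nondegenerate, then its derivative is a degenerate direction of the form. -/
theorem IsProfile.exists_degenerate_direction (hV : PotentialAssumptions V)
    (hF : IsProfile V d R F) (hker : linKer V d R 1 F = aeSpan (deriv F)) :
    ∃ g : PlaneL2, ((hF.memLp_deriv hV).toLp (deriv F), g) ∈ sobolevOne ∧
      quadForm (hessAlong V d R F) ((hF.memLp_deriv hV).toLp (deriv F)) g = 0 := by
  -- Both the linearized equation for `F'` and its `H²` regularity are read off from the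
  -- non-degeneracy assumption.
  have hmem : deriv F ∈ linKer V d R 1 F := by
    rw [hker]
    exact ⟨1, by rw [one_smul]⟩
  obtain ⟨u', u'', hH, hop⟩ := hmem
  refine ⟨hH.memHOne.memLp_deriv.toLp u', hH.memHOne.toLp_mem, ?_⟩
  obtain ⟨C, hC⟩ := hF.exists_hessAlong_bound hV
  have hA := hF.continuous_hessAlong hV
  rw [quadForm_congr (hF.memLp_deriv hV).coeFn_toLp hH.memHOne.memLp_deriv.coeFn_toLp, quadForm,
    integral_add (hH.memHOne.memLp_deriv.integrable_norm_pow (by simp))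
      (memLp_inner_integrable hH.memHOne.memLp (memLp_clm_apply hA hC hH.memHOne.memLp))]
  have h1 : ∫ y, (inner ℝ (deriv F y) (hessAlong V d R F y (deriv F y)) : ℝ) =
      ∫ y, (inner ℝ (deriv F y) (u'' y) : ℝ) := by
    refine integral_congr_ae (hop.mono fun y hy => ?_)
    rw [linOp_one, Pi.zero_apply, neg_add_eq_zero] at hy
    simp only [hy]
  rw [h1, hH.memHOne.integral_inner_deriv hH.memHOne_deriv]
  simp only [real_inner_self_eq_norm_sq, add_neg_cancel]

theorem IsProfile.exists_hasGap (hV : PotentialAssumptions V) (hF : IsProfile V d R F)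
    (hker : linKer V d R 1 F = aeSpan (deriv F)) :
    ∃ c > 0, HasGap (hessAlong V d R F) ((hF.memLp_deriv hV).toLp (deriv F)) c := by
  obtain ⟨C, hC⟩ := hF.exists_hessAlong_bound hV
  obtain ⟨M, c₀, hM, hc₀, hpos⟩ := hF.exists_hessAlong_pos hV
  have hA := hF.continuous_hessAlong hV
  refine _root_.exists_hasGap hA hC (fun u u' hu => hF.quadForm_nonneg hV hu) hM hc₀ hpos _ ?_
  intro x hx hxf hx0
  have h2 := MemHTwo.of_quadForm_eq_zero hA hC (hessAlong_symm hV)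
    (fun u u' hu => hF.quadForm_nonneg hV hu) hx hx0
  have hk : (x.1 : ℝ → Plane) ∈ linKer V d R 1 F := ⟨_, _, h2, Eventually.of_forall fun y => by
    rw [linOp_one, Pi.zero_apply, neg_add_cancel]⟩
  rw [hker] at hk
  obtain ⟨c, hc⟩ := hk
  set f := (hF.memLp_deriv hV).toLp (deriv F) with hf
  have hxc : x.1 = c • f := Lp.ext <| by
    filter_upwards [hc, Lp.coeFn_smul c f, (hF.memLp_deriv hV).coeFn_toLp] with y h1 h2 h3
    rw [h1, h2, Pi.smul_apply, Pi.smul_apply, h3]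
  have hf0 : f ≠ 0 := hF.toLp_deriv_ne_zero hV
  have hx1 : x.1 = 0 := by
    rw [hxc, real_inner_smul_left, real_inner_self_eq_norm_sq, mul_eq_zero] at hxf
    rcases hxf with h | h
    · rw [hxc, h, zero_smul]
    · exact absurd (norm_eq_zero.1 (pow_eq_zero_iff two_ne_zero |>.1 h)) hf0
  have hx2 : x.2 = 0 := by
    have h0 : (x.1 : ℝ → Plane) =ᵐ[volume] 0 := by
      rw [hx1]
      exact Lp.coeFn_zero ..
    rw [quadForm_congr h0 (ae_eq_refl _), quadForm] at hx0
    simp only [Pi.zero_apply, inner_zero_left, add_zero] at hx0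
    rw [← norm_sq_eq_integral] at hx0
    exact norm_eq_zero.1 (pow_eq_zero_iff two_ne_zero |>.1 hx0)
  exact Prod.ext hx1 hx2

/-- Two contributions, each at most `δ / 2`: the change of profile, by uniform continuity of `hess
V` at the points of a compact ball, and the change of `d² / R²`, continuous because `R ≠ 0`. -/
theorem eventually_hessAlong_sub_le (hV : PotentialAssumptions V) (d : ℝ) {R : ℝ} (hR : R ≠ 0)
    {F : ℝ → ℝ → Plane} {M : ℝ} (hM : ∀ y, ‖F R y‖ ≤ M) (hcont : TendstoUniformly F (F R) (𝓝 R))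
    {δ : ℝ} (hδ : 0 < δ) : ∀ᶠ R' in 𝓝 R, ∀ y,
      ‖hessAlong V d R' (F R') y - hessAlong V d R (F R) y‖ ≤ δ := by
  have huc := (isCompact_closedBall (0 : Plane) M).uniformContinuousAt_of_continuousAt (hess V)
    (fun a _ => (continuous_hess hV.contDiff).continuousAt) (Metric.dist_mem_uniformity (half_pos hδ))
  obtain ⟨η, hη, h⟩ := Metric.mem_uniformity_dist.1 huc
  have hq : Tendsto (fun R' : ℝ => ‖(d ^ 2 / R' ^ 2 - d ^ 2 / R ^ 2) • sigmaProj‖) (𝓝 R) (𝓝 0) := by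
    have : ContinuousAt (fun R' : ℝ => ‖(d ^ 2 / R' ^ 2 - d ^ 2 / R ^ 2) • sigmaProj‖) R := by
      have : R ^ 2 ≠ 0 := pow_ne_zero 2 hR
      fun_prop (disch := assumption)
    have h0 := this.tendsto
    rwa [sub_self, zero_smul ℝ sigmaProj, norm_zero] at h0
  filter_upwards [Metric.tendstoUniformly_iff.1 hcont η hη,
    hq.eventually (gt_mem_nhds (half_pos hδ))] with R' h1 h2 y
  have h3 : dist (hess V (F R y)) (hess V (F R' y)) < δ / 2 :=
    h (h1 y) (by simpa using hM y)
  have e : hessAlong V d R' (F R') y - hessAlong V d R (F R) y =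
      (hess V (F R' y) - hess V (F R y)) + (d ^ 2 / R' ^ 2 - d ^ 2 / R ^ 2) • sigmaProj := by
    rw [hessAlong, hessAlong, hess_shiftedPotential hV, hess_shiftedPotential hV,
      sub_smul _ _ sigmaProj]
    abel
  rw [dist_comm, dist_eq_norm] at h3
  rw [e]
  exact (norm_add_le _ _).trans (by linarith)

end ProfileGap

/-! ### Uniformity of the gap on compact parameter sets. -/

section UniformGap

variable {V : Plane → ℝ} {d R : ℝ} {F : ℝ → Plane}

theorem HasGap.le_quadForm {A : ℝ → Plane →L[ℝ] Plane} {f : ℝ → Plane} (hf : MemLp f 2) {c : ℝ}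
    (h : HasGap A (hf.toLp f) c) {u u' : ℝ → Plane} (hu : MemHOne u u')
    (horth : ∫ y, inner ℝ (u y) (f y) = 0) : c * ∫ y, ‖u y‖ ^ 2 ≤ quadForm A u u' := by
  have h1 := h _ hu.toLp_mem (by rw [inner_toLp, horth])
  rwa [norm_sq_toLp, quadForm_congr hu.memLp.coeFn_toLp hu.memLp_deriv.coeFn_toLp] at h1

/-- The spectral gap is uniform for parameters in a compact set. -/
theorem exists_uniform_gap (hV : PotentialAssumptions V) (d : ℝ) {I : Set ℝ}
    (hI : ∀ R ∈ I, R ≠ 0) {F : ℝ → ℝ → Plane} (hF : ∀ R ∈ I, IsProfile V d R (F R))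
    (hker : ∀ R ∈ I, linKer V d R 1 (F R) = aeSpan (deriv (F R)))
    (hcont : ∀ R ∈ I, TendstoUniformly F (F R) (𝓝 R)) {K : Set ℝ} (hK : IsCompact K) (hKI : K ⊆ I) :
    ∃ c > 0, ∀ R ∈ K, ∀ u u' : ℝ → Plane, MemHOne u u' →
      ∫ y, inner ℝ (u y) (deriv (F R) y) = 0 →
        c * ∫ y, ‖u y‖ ^ 2 ≤ quadForm (hessAlong V d R (F R)) u u' := by
  -- Having a common gap constant is inherited by subsets and by finite unions, so it suffices to
  -- find one near each `R ∈ K`.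
  refine hK.induction_on (p := fun s => ∃ c > 0, ∀ R ∈ s, ∀ u u' : ℝ → Plane, MemHOne u u' →
      ∫ y, inner ℝ (u y) (deriv (F R) y) = 0 →
        c * ∫ y, ‖u y‖ ^ 2 ≤ quadForm (hessAlong V d R (F R)) u u')
    ⟨1, one_pos, fun R hR => hR.elim⟩ ?_ ?_ fun R hR => ?_
  · rintro s t hst ⟨c, hc, h⟩
    exact ⟨c, hc, fun R hR => h R (hst hR)⟩
  · rintro s t ⟨c, hc, h⟩ ⟨c', hc', h'⟩
    refine ⟨min c c', lt_min hc hc', fun R hR u u' hu ho => ?_⟩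
    have h0 : 0 ≤ ∫ y, ‖u y‖ ^ 2 := integral_nonneg fun _ => by positivity
    rcases hR with hR | hR
    · exact (mul_le_mul_of_nonneg_right (min_le_left _ _) h0).trans (h R hR u u' hu ho)
    · exact (mul_le_mul_of_nonneg_right (min_le_right _ _) h0).trans (h' R hR u u' hu ho)
  · have hFR := hF R (hKI hR)
    obtain ⟨c, hc, hgap⟩ := hFR.exists_hasGap hV (hker R (hKI hR))
    obtain ⟨g, hg, hg0⟩ := hFR.exists_degenerate_direction hV (hker R (hKI hR))
    obtain ⟨C, hC⟩ := hFR.exists_hessAlong_bound hV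
    obtain ⟨M, hM⟩ := hFR.exists_bound
    -- The perturbation loses `2δ`; taking `δ = c / 4` keeps half of the gap.
    have hev := eventually_hessAlong_sub_le hV d (hI R (hKI hR)) hM (hcont R (hKI hR))
      (show 0 < c / 4 by positivity)
    refine ⟨_, inter_mem (mem_nhdsWithin_of_mem_nhds hev) self_mem_nhdsWithin, c / 2, half_pos hc,
      fun R' hR' u u' hu ho => ?_⟩
    obtain ⟨hδ, hR'K⟩ := hR'
    have hFR' := hF R' (hKI hR'K)
    obtain ⟨g', hg', hg0'⟩ := hFR'.exists_degenerate_direction hV (hker R' (hKI hR'K))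
    obtain ⟨C', hC'⟩ := hFR'.exists_hessAlong_bound hV
    have h := HasGap.perturb (hFR.continuous_hessAlong hV) hC (hFR'.continuous_hessAlong hV) hC' hδ
      (hessAlong_symm hV) (fun u u' hu => hFR.quadForm_nonneg hV hu) hg
      (hFR.toLp_deriv_ne_zero hV) hg0 hg' (hFR'.toLp_deriv_ne_zero hV) hg0' hc hgap
    rw [show c / 2 = c - 2 * (c / 4) by ring]
    exact h.le_quadForm (hFR'.memLp_deriv hV) hu ho

end UniformGap

/-! ### Reduction to `ε = 1` by dilation. -/

section Scaling

variable {u u' u'' v : ℝ → Plane} {a : ℝ}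

theorem quasiMeasurePreserving_mul_left (ha : a ≠ 0) :
    Measure.QuasiMeasurePreserving (fun y : ℝ => a * y) volume volume :=
  ⟨measurable_const_mul a, by
    rw [Real.map_volume_mul_left ha]
    exact Measure.smul_absolutelyContinuous⟩

theorem memLp_comp_mul (hu : MemLp u 2) (ha : a ≠ 0) : MemLp (fun y => u (a * y)) 2 := by
  have hm : AEStronglyMeasurable (fun y => u (a * y)) :=
    hu.1.comp_quasiMeasurePreserving (quasiMeasurePreserving_mul_left ha)
  rw [memLp_two_iff_integrable_sq_norm hm]
  exact ((memLp_two_iff_integrable_sq_norm hu.1).1 hu).comp_mul_left' ha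

theorem MemHOne.comp_mul (h : MemHOne u u') (ha : a ≠ 0) :
    MemHOne (fun y => u (a * y)) (fun y => a • u' (a * y)) :=
  ⟨memLp_comp_mul h.memLp ha, (memLp_comp_mul h.memLp_deriv ha).const_smul a, h.weak.comp_mul ha⟩

theorem MemHOne.const_smul (h : MemHOne u u') (c : ℝ) : MemHOne (c • u) (c • u') :=
  ⟨h.memLp.const_smul c, h.memLp_deriv.const_smul c, h.weak.const_smul c⟩

theorem MemHTwo.comp_mul (h : MemHTwo u u' u'') (ha : a ≠ 0) :
    MemHTwo (fun y => u (a * y)) (fun y => a • u' (a * y)) (fun y => a • a • u'' (a * y)) :=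
  ⟨h.memHOne.comp_mul ha, (h.memHOne_deriv.comp_mul ha).const_smul a⟩

variable {V : Plane → ℝ} {d R : ℝ} {F : ℝ → Plane} {ε : ℝ}

theorem deriv_rescale (ε : ℝ) (F : ℝ → Plane) (y : ℝ) :
    deriv (rescale ε F) y = ε⁻¹ • deriv F (ε⁻¹ * y) := by
  have : rescale ε F = fun y => F (ε⁻¹ * y) := funext fun y => by rw [rescale, div_eq_inv_mul]
  rw [this, deriv_comp_mul_left]

theorem rescale_mul (hε : ε ≠ 0) (F : ℝ → Plane) (y : ℝ) : rescale ε F (ε * y) = F y := by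
  rw [rescale, mul_div_cancel_left₀ _ hε]

theorem linOp_comp_mul (hε : ε ≠ 0) (y : ℝ) :
    linOp V d R 1 F (fun y => u (ε * y)) (fun y => ε • ε • u'' (ε * y)) y =
      ε ^ 2 • linOp V d R ε (rescale ε F) u u'' (ε * y) := by
  rw [linOp_one, linOp, rescale_mul hε, smul_add, smul_smul, smul_smul, smul_neg, hessAlong,
    mul_one_div_cancel (pow_ne_zero 2 hε), one_smul, sq]

theorem mem_linKer_rescale_iff (hε : ε ≠ 0) :
    u ∈ linKer V d R ε (rescale ε F) ↔ (fun y => u (ε * y)) ∈ linKer V d R 1 F := by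
  constructor
  · rintro ⟨u', u'', h, hop⟩
    refine ⟨_, _, h.comp_mul hε, ?_⟩
    filter_upwards [(quasiMeasurePreserving_mul_left hε).ae_eq_comp hop] with y hy
    rw [linOp_comp_mul hε]
    simp only [Function.comp_apply, Pi.zero_apply] at hy ⊢
    rw [hy, smul_zero]
  · rintro ⟨v', v'', h, hop⟩
    have h2 := h.comp_mul (inv_ne_zero hε)
    simp only [mul_inv_cancel_left₀ hε] at h2
    refine ⟨_, _, h2, ?_⟩
    filter_upwards [(quasiMeasurePreserving_mul_left (inv_ne_zero hε)).ae_eq_comp hop] with y hy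
    have h3 := linOp_comp_mul (V := V) (d := d) (R := R) (F := F) (u := u)
      (u'' := fun y => ε⁻¹ • ε⁻¹ • v'' (ε⁻¹ * y)) hε (ε⁻¹ * y)
    simp only [mul_inv_cancel_left₀ hε, inv_mul_cancel_left₀ hε, smul_inv_smul₀ hε] at h3
    simp only [Function.comp_apply, Pi.zero_apply] at hy ⊢
    rw [hy] at h3
    exact (smul_eq_zero.1 h3.symm).resolve_left (pow_ne_zero 2 hε)

theorem mem_aeSpan_rescale_iff (hε : ε ≠ 0) :
    u ∈ aeSpan (deriv (rescale ε F)) ↔ (fun y => u (ε * y)) ∈ aeSpan (deriv F) := by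
  constructor
  · rintro ⟨c, hc⟩
    refine ⟨c * ε⁻¹, ?_⟩
    filter_upwards [(quasiMeasurePreserving_mul_left hε).ae_eq_comp hc] with y hy
    simpa only [Function.comp_apply, Pi.smul_apply, deriv_rescale, inv_mul_cancel_left₀ hε,
      smul_smul] using hy
  · rintro ⟨c, hc⟩
    refine ⟨c * ε, ?_⟩
    filter_upwards [(quasiMeasurePreserving_mul_left (inv_ne_zero hε)).ae_eq_comp hc] with y hy
    simpa only [Function.comp_apply, Pi.smul_apply, deriv_rescale, mul_inv_cancel_left₀ hε,
      smul_smul, mul_inv_cancel_right₀ hε] using hy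

/-- The Jacobian contributes `ε`, and the form of the dilated function is `ε²` times the pulled-back
integrand. -/
theorem linForm_rescale (hε : 0 < ε) :
    linForm V d R ε (rescale ε F) u u' =
      ε⁻¹ * quadForm (hessAlong V d R F) (fun y => u (ε * y)) (fun y => ε • u' (ε * y)) := by
  have h := Measure.integral_comp_mul_left (fun y => ‖u' y‖ ^ 2 +
    1 / ε ^ 2 * (inner ℝ (u y) (hess (shiftedPotential V d R) (rescale ε F y) (u y)) : ℝ)) ε
  rw [abs_of_pos (inv_pos.2 hε), smul_eq_mul, eq_inv_mul_iff_mul_eq₀ hε.ne'] at h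
  rw [linForm, ← h, quadForm, ← integral_const_mul, ← integral_const_mul]
  congr 1
  ext y
  rw [rescale_mul hε.ne', norm_smul, Real.norm_of_nonneg hε.le, hessAlong]
  field_simp

theorem integral_inner_linOp (hV : PotentialAssumptions V) (hF : IsProfile V d R F)
    (h : MemHTwo u u' u'') :
    ∫ y, inner ℝ (u y) (linOp V d R ε (rescale ε F) u u'' y) =
      linForm V d R ε (rescale ε F) u u' := by
  obtain ⟨C, hC⟩ := hF.exists_hessAlong_bound hV
  have hA : Continuous fun y => hessAlong V d R F (y / ε) :=
    (hF.continuous_hessAlong hV).comp (continuous_id.div_const ε)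
  have i1 := memLp_inner_integrable h.memHOne.memLp h.memHOne_deriv.memLp_deriv
  have i2 := (memLp_inner_integrable h.memHOne.memLp
    (memLp_clm_apply hA (fun y => hC _) h.memHOne.memLp)).const_mul (1 / ε ^ 2)
  have i3 := h.memHOne.memLp_deriv.integrable_norm_pow (p := 2) (by simp)
  have e1 : linForm V d R ε (rescale ε F) u u' = (∫ y, ‖u' y‖ ^ 2) +
      ∫ y, 1 / ε ^ 2 * (inner ℝ (u y) (hessAlong V d R F (y / ε) (u y)) : ℝ) :=
    integral_add i3 i2
  have e2 : ∫ y, inner ℝ (u y) (linOp V d R ε (rescale ε F) u u'' y) =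
      ∫ y, (-(inner ℝ (u y) (u'' y) : ℝ) +
        1 / ε ^ 2 * (inner ℝ (u y) (hessAlong V d R F (y / ε) (u y)) : ℝ)) := by
    congr 1
    ext y
    rw [linOp, inner_add_right, inner_neg_right, real_inner_smul_right, hessAlong, rescale]
  rw [e1, e2, integral_add i1.fun_neg i2, integral_neg, h.memHOne.integral_inner_deriv h.memHOne_deriv,
    neg_neg]
  simp only [real_inner_self_eq_norm_sq]

/-- The squared `L²` norm and `linForm` acquire factors `ε⁻¹` and `ε` under dilation; their quotient
is the `ε⁻²` of the estimate, so the constant `c⁻¹` is independent of `ε`. -/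
theorem spectral_estimate_rescale {c : ℝ}
    (hgap : ∀ u u' : ℝ → Plane, MemHOne u u' → ∫ y, inner ℝ (u y) (deriv F y) = 0 →
      c * ∫ y, ‖u y‖ ^ 2 ≤ quadForm (hessAlong V d R F) u u') (hc : 0 < c) (hε : 0 < ε)
    (hu : MemHOne u u') (horth : ∫ y, inner ℝ (u y) (deriv (rescale ε F) y) = 0) :
    1 / ε ^ 2 * ∫ y, ‖u y‖ ^ 2 ≤ c⁻¹ * linForm V d R ε (rescale ε F) u u' := by
  have h1 := Measure.integral_comp_mul_left (fun y => ‖u y‖ ^ 2) ε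
  have h2 := Measure.integral_comp_mul_left
    (fun y => (inner ℝ (u y) (deriv (rescale ε F) y) : ℝ)) ε
  rw [horth, smul_zero] at h2
  simp only [deriv_rescale, inv_mul_cancel_left₀ hε.ne', real_inner_smul_right] at h2
  rw [integral_const_mul, mul_eq_zero, or_iff_right (inv_ne_zero hε.ne')] at h2
  have h3 := hgap _ _ (hu.comp_mul hε.ne') h2
  rw [h1, abs_of_pos (inv_pos.2 hε), smul_eq_mul] at h3
  rw [linForm_rescale hε]
  calc 1 / ε ^ 2 * ∫ y, ‖u y‖ ^ 2 = c⁻¹ * (ε⁻¹ * (c * (ε⁻¹ * ∫ y, ‖u y‖ ^ 2))) := by field_simp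
    _ ≤ _ := by gcongr

end Scaling

/-! ### The spectral estimate. -/

theorem mainTheorem3 (V : Plane → ℝ) (hV : PotentialAssumptions V) (d : ℝ)
    (r₀ : ℝ) (r₁ : EReal) (hr₀ : 0 ≤ r₀) (hr : (r₀ : EReal) < r₁)
    (F₀ : ℝ → ℝ → Plane)
    (hF₀ : ∀ R ∈ paramInterval r₀ r₁, IsProfile V d R (F₀ R))
    (hnondeg : ∀ R ∈ paramInterval r₀ r₁,
      linKer V d R 1 (F₀ R) = aeSpan (deriv (F₀ R)))
    (hcont : ∀ R ∈ paramInterval r₀ r₁, TendstoUniformly F₀ (F₀ R) (𝓝 R)) :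
    (∀ R ∈ paramInterval r₀ r₁, ∀ ε : ℝ, 0 < ε →
      linKer V d R ε (rescale ε (F₀ R)) = aeSpan (deriv (rescale ε (F₀ R)))) ∧
    (∀ K : Set ℝ, IsCompact K → K ⊆ paramInterval r₀ r₁ →
      ∃ C : ℝ, 0 < C ∧ ∀ R ∈ K, ∀ ε : ℝ, 0 < ε →
        (∀ ξ ξ' : ℝ → Plane, MemHOne ξ ξ' →
          ∫ y, inner ℝ (ξ y) (deriv (rescale ε (F₀ R)) y) = 0 →
          1 / ε ^ 2 * ∫ y, ‖ξ y‖ ^ 2 ≤ C * linForm V d R ε (rescale ε (F₀ R)) ξ ξ') ∧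
        (∀ ξ ξ' ξ'' : ℝ → Plane, MemHTwo ξ ξ' ξ'' →
          ∫ y, inner ℝ (ξ y) (deriv (rescale ε (F₀ R)) y) = 0 →
          1 / ε ^ 2 * ∫ y, ‖ξ y‖ ^ 2 ≤
            C * ∫ y, inner ℝ (ξ y) (linOp V d R ε (rescale ε (F₀ R)) ξ ξ'' y))) := by
  have hI : ∀ R ∈ paramInterval r₀ r₁, R ≠ 0 := fun R hR => (hr₀.trans_lt hR.1).ne'
  refine ⟨fun R hR ε hε => ?_, fun K hK hKI => ?_⟩
  · ext u
    rw [mem_linKer_rescale_iff hε.ne', hnondeg R hR, mem_aeSpan_rescale_iff hε.ne']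
  · obtain ⟨c, hc, h⟩ := exists_uniform_gap hV d hI hF₀ hnondeg hcont hK hKI
    have key : ∀ R ∈ K, ∀ ε : ℝ, 0 < ε → ∀ ξ ξ' : ℝ → Plane, MemHOne ξ ξ' →
        ∫ y, inner ℝ (ξ y) (deriv (rescale ε (F₀ R)) y) = 0 →
        1 / ε ^ 2 * ∫ y, ‖ξ y‖ ^ 2 ≤ c⁻¹ * linForm V d R ε (rescale ε (F₀ R)) ξ ξ' :=
      fun R hR ε hε ξ ξ' hξ ho => spectral_estimate_rescale (h R hR) hc hε hξ ho
    refine ⟨c⁻¹, inv_pos.2 hc, fun R hR ε hε => ⟨key R hR ε hε, fun ξ ξ' ξ'' hξ ho => ?_⟩⟩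
    rw [integral_inner_linOp hV (hF₀ R (hKI hR)) hξ]
    exact key R hR ε hε ξ ξ' hξ.memHOne ho
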